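/- Let $n\in\{2,3\}$. **Geometry and meshes.** A fractured domain $\Omega\subset\mathbb R^n$ consists of finitely many flat connected subdomains $\Omega_i$ of dimensions $d_i\in\{0,\dots,n\}$ (rock, fractures, intersections), where subdomains of lower dimension have been removed from those of higher dimension. Each side from which a subdomain $\Omega_j$ of dimension $d$ is faced by a subdomain of dimension $d+1$ is an interface $\Gamma_g$ (a copy of $\Omega_j$); $\Gamma$ is the union of the interfaces. The subdomains are connected with each other through the interfaces, and the Dirichlet part $\partial\Omega_D$ of $\partial\Omega$ contains at least one facet of the mesh. Each $\Omega_i$ carries a simplicial mesh which resolves the subdomains of one dimension less and is conforming inside $\Omega_i$; each $\Gamma_g$ carries a simplicial mortar mesh, which need not match its neighbours. The subdomain meshes are shape regular with constant $\sigma$: each element $T$ of positive dimension contains a ball, of the dimension of $T$, of radius $\rho$ with $\operatorname{diam}T\le\sigma\rho$. **Spaces.** $Q_h$ and $\Lambda_h$ are the piecewise constants on the subdomain meshes and on the mortar meshes. $V_h$ is the space of lowest-order Raviart–Thomas fields on the subdomains of positive dimension with continuous normal components on the interior facets and zero normal component on the boundary facets that lie neither on $\Gamma$ nor on $\partial\Omega_D$.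 $V_{0h}\subset V_h$ is the subspace with zero normal component on $\Gamma$, and $W_h=V_{0h}\times\Lambda_h$. $R_h:\Lambda_h\to V_h$ is a linear extension operator: $R_h\mu\cdot\nu$ is on $\Gamma$ the $L^2(\Gamma)$-projection of $\mu$ to the normal traces of $V_h$, and it is zero on all other boundary facets. **Forms.** Let the permeability $K$ be a symmetric positive definite tensor, constant on each subdomain; let the normal permeability $K_\nu$ be bounded above and below by positive constants on each interface, and let the aperture $\gamma>0$ be constant on each interface. For $w=[u_0,\lambda]$, $r=[v_0,\mu]$ in $W_h$ put $u=u_0+R_h\lambda$, $v=v_0+R_h\mu$ and $$a(w,r)=(K^{-1}u,v)_\Omega+(\gamma K_\nu^{-1}\lambda,\mu)_\Gamma,$$ $$a^D(w,r)=\sum_T\sum_{f\subset\partial T}(u\cdot\nu_f)(v\cdot\nu_f)\,(K^{-1}\phi_f,\phi_f)_T+(\gamma K_\nu^{-1}\lambda,\mu)_\Gamma,$$ $$b(r,q)=-(q,\nabla\cdot v+[\![\mu]\!])_\Omega,$$ where $[\![\mu]\!]|_{\Omega_j}=-\sum_g\mu|_{\Gamma_g}$, summed over the interfaces that are sides of $\Omega_j$,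 and $\phi_f$ is the Raviart–Thomas basis function on $T$ with normal component $1$ on the facet $f$ and $0$ on the other facets. Put $\|r\|_a^2=a(r,r)$ and $\|r\|_{a^D}^2=a^D(r,r)$. **Theorem.** There is a unique linear operator $D_h:Q_h\to W_h$ (the discrete gradient) with $a^D(D_hp,r)=b(r,p)$ for all $p\in Q_h$, $r\in W_h$. Let $$\mathcal L(w,p;r,q)=a(w,r)+a^D(D_hp,r)+a^D(D_hq,w),\qquad |||(r,q)|||^2=\|r\|_a^2+\|D_hq\|_{a^D}^2 .$$ Then $$|\mathcal L(w,p;r,q)|\le\alpha\,|||(w,p)|||\;|||(r,q)|||\qquad\text{for all }(w,p),(r,q)\in W_h\times Q_h,$$ $$\inf_{0\ne(r,q)\in W_h\times Q_h}\;\sup_{0\ne(w,p)\in W_h\times Q_h}\frac{\mathcal L(w,p;r,q)}{|||(w,p)|||\;|||(r,q)|||}\ge\beta,$$ where $\beta>0$ depends only on $n$ and $\sigma$, and $\alpha>0$ depends only on $n$, $\sigma$ and an upper bound $\kappa$ for the ratio of the largest to the smallest eigenvalue of $K$ on each subdomain. In particular, for scalar permeabilities ($\kappa=1$) both constants depend only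 on the shape regularity of the mesh, and not on the mesh size, $K$, $K_\nu$ or $\gamma$. -/

import Mathlib

open MeasureTheory
open scoped BigOperators

noncomputable section

namespace MixedDim

/-- The ambient Euclidean space `ℝⁿ`. -/
abbrev E (n : ℕ) := EuclideanSpace ℝ (Fin n)

/-! ### Facets of a simplex and the lowest-order Raviart–Thomas element -/

section Simplex

variable {n d : ℕ}

/-- The facet of `s` opposite to the vertex `k`. -/
def facet (s : Affine.Simplex ℝ (E n) d) (k : Fin (d + 1)) : Set (E n) :=
  convexHull ℝ (s.points '' {k}ᶜ)

/-- Barycentre of a simplex. -/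
def barycentre (s : Affine.Simplex ℝ (E n) d) : E n :=
  Finset.univ.centroid ℝ s.points

/-- Barycentre of the facet opposite to the vertex `k`. -/
def facetBarycentre (s : Affine.Simplex ℝ (E n) d) (k : Fin (d + 1)) : E n :=
  (Finset.univ.erase k).centroid ℝ s.points

/-- The altitude vector: it leads from the vertex `k` to its orthogonal projection on the affine
hull of the opposite facet. -/
def altitudeVec (s : Affine.Simplex ℝ (E n) d) (k : Fin (d + 1)) : E n :=
  (vectorSpan ℝ (s.points '' {k}ᶜ))ᗮ.starProjection (facetBarycentre s k - s.points k)

/-- The height of `s` over the facet `k`. -/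
def height (s : Affine.Simplex ℝ (E n) d) (k : Fin (d + 1)) : ℝ := ‖altitudeVec s k‖

/-- The outer unit normal `ν_f` of the facet `k` (within the affine hull of `s`). -/
def outerNormal (s : Affine.Simplex ℝ (E n) d) (k : Fin (d + 1)) : E n :=
  (height s k)⁻¹ • altitudeVec s k

/-- The `RT₀` basis function `φ_f` of the facet `k`: its normal component is `1` on that facet
and `0` on all the others. -/
def basisField (s : Affine.Simplex ℝ (E n) d) (k : Fin (d + 1)) (x : E n) : E n :=
  (height s k)⁻¹ • (x - s.points k)

/-- The local `RT₀` field `x ↦ a + b (x - x_s)`, `x_s` the barycentre of `s`, given by a vector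
`a` tangential to `s` and a number `b`. -/
def rtField {D : Submodule ℝ (E n)} (s : Affine.Simplex ℝ (E n) d) (v : D × ℝ) (x : E n) : E n :=
  (v.1 : E n) + v.2 • (x - barycentre s)

/-- The divergence, within the `d`-dimensional affine hull of the simplex, of the field
`x ↦ a + b (x - x_s)`. -/
def rtDiv (d : ℕ) {D : Submodule ℝ (E n)} (v : D × ℝ) : ℝ := d * v.2

/-- The normal component `v · ν_f` of a local `RT₀` field on the facet `k`; it is constant on the
facet, and is evaluated at the barycentre of the facet. -/
def rtFlux {D : Submodule ℝ (E n)} (s : Affine.Simplex ℝ (E n) d) (v : D × ℝ) (k : Fin (d + 1)) :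
    ℝ :=
  inner ℝ (rtField s v (facetBarycentre s k)) (outerNormal s k)

theorem rtFlux_add {D : Submodule ℝ (E n)} (s : Affine.Simplex ℝ (E n) d) (v w : D × ℝ)
    (k : Fin (d + 1)) : rtFlux s (v + w) k = rtFlux s v k + rtFlux s w k := by
  simp only [rtFlux, rtField, Prod.fst_add, Prod.snd_add, Submodule.coe_add, add_smul,
    inner_add_left]
  ring

theorem rtFlux_smul {D : Submodule ℝ (E n)} (s : Affine.Simplex ℝ (E n) d) (c : ℝ) (v : D × ℝ)
    (k : Fin (d + 1)) : rtFlux s (c • v) k = c * rtFlux s v k := by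
  simp only [rtFlux, rtField, Prod.smul_fst, Prod.smul_snd, Submodule.coe_smul, smul_eq_mul,
    inner_add_left, inner_smul_left, RCLike.conj_to_real]
  ring

theorem rtFlux_zero {D : Submodule ℝ (E n)} (s : Affine.Simplex ℝ (E n) d)
    (k : Fin (d + 1)) : rtFlux s (0 : D × ℝ) k = 0 := by
  simp [rtFlux, rtField]

end Simplex

/-! ### Mixed-dimensional geometry and its meshes -/

/-- The data of a meshed mixed-dimensional geometry in `ℝⁿ`.

* `Sub` indexes the subdomains `Ω_i^d` of all dimensions, `dim i` is the dimension of the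
  subdomain `i` and `plane i` its affine hull;
* `Cell i` indexes the elements of the mesh of the subdomain `i`;
* `Iface` indexes the interfaces: an interface `g` is the side of the subdomain `lower g` that
  faces the subdomain `upper g` of one dimension more, and `normal g` is the unit normal on it
  that points out of `upper g` (the two sides of a fracture are two interfaces, also when they face
  the same subdomain);
* `MCell g` indexes the elements of the mortar mesh on the interface `g`, which need not match the
  adjacent meshes;
* `bdryD` is the Dirichlet part of the boundary. -/
structure MeshData (n : ℕ) where
  Sub : Type
  [fintypeSub : Fintype Sub]
  dim : Sub → ℕ
  plane : Sub → AffineSubspace ℝ (E n)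
  Cell : Sub → Type
  [fintypeCell : ∀ i, Fintype (Cell i)]
  cell : ∀ i, Cell i → Affine.Simplex ℝ (E n) (dim i)
  Iface : Type
  [fintypeIface : Fintype Iface]
  lower : Iface → Sub
  upper : Iface → Sub
  normal : Iface → E n
  MCell : Iface → Type
  [fintypeMCell : ∀ g, Fintype (MCell g)]
  mcell : ∀ g, MCell g → Affine.Simplex ℝ (E n) (dim (lower g))
  bdryD : Set (E n)

attribute [instance] MeshData.fintypeSub MeshData.fintypeCell MeshData.fintypeIface
  MeshData.fintypeMCell

namespace MeshData

variable {n : ℕ} (M : MeshData n)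

/-- The closed region covered by the mesh of the subdomain `i`. -/
def region (i : M.Sub) : Set (E n) := ⋃ T : M.Cell i, (M.cell i T).closedInterior

/-- The facet `k` of the element `T` lies on a subdomain of one dimension less. -/
def OnGamma (i : M.Sub) (T : M.Cell i) (k : Fin (M.dim i + 1)) : Prop :=
  ∃ j, M.dim j + 1 = M.dim i ∧ facet (M.cell i T) k ⊆ M.region j

/-- The facet `k` of the element `T` of the subdomain `upper g` belongs to the interface `g`. -/
def InIface (g : M.Iface) (T : M.Cell (M.upper g)) (k : Fin (M.dim (M.upper g) + 1)) : Prop :=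
  facet (M.cell _ T) k ⊆ M.region (M.lower g) ∧ outerNormal (M.cell _ T) k = M.normal g

/-- The facet `k` of `T` is an interior facet of the mesh of the subdomain `i`, shared with the
element `T'`, whose facet `k'` it is. Facets on the two sides of a fracture are not identified. -/
def InteriorPair (i : M.Sub) (T : M.Cell i) (k : Fin (M.dim i + 1))
    (T' : M.Cell i) (k' : Fin (M.dim i + 1)) : Prop :=
  0 < M.dim i ∧ T ≠ T' ∧ (M.cell i T).points '' {k}ᶜ = (M.cell i T').points '' {k'}ᶜ ∧
    ¬ M.OnGamma i T k

/-- The facet `k` of `T` is an outer facet: neither interior nor on an interface. -/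
def Outer (i : M.Sub) (T : M.Cell i) (k : Fin (M.dim i + 1)) : Prop :=
  0 < M.dim i ∧ ¬ M.OnGamma i T k ∧ ∀ T' k', ¬ M.InteriorPair i T k T' k'

/-- The outer facet `k` of `T` lies on the Dirichlet boundary. -/
def DirichletFacet (i : M.Sub) (T : M.Cell i) (k : Fin (M.dim i + 1)) : Prop :=
  M.Outer i T k ∧ facet (M.cell i T) k ⊆ M.bdryD

/-- The data `M` describe a mixed-dimensional geometry with triangulated flat subdomains and
mortar meshes on the interfaces. -/
structure IsMesh : Prop where
  cell_nonempty : ∀ i, Nonempty (M.Cell i)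
  /-- Subdomains are flat. -/
  affineSpan_cell : ∀ i T, affineSpan ℝ (Set.range (M.cell i T).points) = M.plane i
  /-- Elements of equal dimension do not overlap. -/
  cell_overlap : ∀ (i j : M.Sub) (T : M.Cell i) (T' : M.Cell j), M.dim i = M.dim j →
    (⟨i, T⟩ : Σ i, M.Cell i) ≠ ⟨j, T'⟩ →
    μHE[M.dim i] ((M.cell i T).closedInterior ∩ (M.cell j T').closedInterior) = 0
  /-- The subdomains of lower dimension have been removed from those of higher dimension. -/
  cell_disjoint : ∀ (i j : M.Sub) (T : M.Cell i), M.dim j < M.dim i →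
    Disjoint (M.cell i T).interior (M.region j)
  /-- Away from the subdomains of lower dimension, two elements of a subdomain meet in a common
  face. -/
  conforming : ∀ (i : M.Sub) (T T' : M.Cell i), T ≠ T' →
    (M.cell i T).closedInterior ∩ (M.cell i T').closedInterior ⊆
      convexHull ℝ (Set.range (M.cell i T).points ∩ Set.range (M.cell i T').points) ∪
        ⋃ j, ⋃ _ : M.dim j < M.dim i, M.region j
  /-- At most two elements share an interior facet. -/
  neighbour_unique : ∀ (i : M.Sub) (T T₁ T₂ : M.Cell i) (k k₁ k₂ : Fin (M.dim i + 1)),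
    M.InteriorPair i T k T₁ k₁ → M.InteriorPair i T k T₂ k₂ → T₁ = T₂
  /-- The meshes resolve the subdomains of one dimension less. -/
  fitted : ∀ (i j : M.Sub) (T : M.Cell i) (k : Fin (M.dim i + 1)), M.dim j + 1 = M.dim i →
    facet (M.cell i T) k ⊆ M.region j ∨ μHE[M.dim j] (facet (M.cell i T) k ∩ M.region j) = 0
  dim_upper : ∀ g, M.dim (M.upper g) = M.dim (M.lower g) + 1
  /-- Every facet on a subdomain of one dimension less belongs to exactly one interface. -/
  iface_complete : ∀ (i j : M.Sub) (T : M.Cell i) (k : Fin (M.dim i + 1)),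
    M.dim j + 1 = M.dim i → facet (M.cell i T) k ⊆ M.region j →
    ∃! g, M.lower g = j ∧ M.upper g = i ∧ M.normal g = outerNormal (M.cell i T) k
  /-- The facets that belong to an interface form a mesh of it. -/
  iface_cover : ∀ g, (⋃ (T) (k) (_ : M.InIface g T k), facet (M.cell _ T) k) = M.region (M.lower g)
  iface_overlap : ∀ g T k T' k', M.InIface g T k → M.InIface g T' k' → (T, k) ≠ (T', k') →
    μHE[M.dim (M.lower g)] (facet (M.cell _ T) k ∩ facet (M.cell _ T') k') = 0
  /-- The mortar elements form a mesh of the interface. -/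
  mortar_cover : ∀ g, (⋃ m, (M.mcell g m).closedInterior) = M.region (M.lower g)
  mortar_overlap : ∀ g m m', m ≠ m' →
    μHE[M.dim (M.lower g)] ((M.mcell g m).closedInterior ∩ (M.mcell g m').closedInterior) = 0
  /-- Every subdomain is connected. -/
  sub_connected : ∀ i (T T' : M.Cell i),
    Relation.ReflTransGen (fun A B => ∃ k k', M.InteriorPair i A k B k') T T'
  /-- The fractured domain is connected. -/
  connected : ∀ i j, Relation.EqvGen (fun i j => ∃ g, M.lower g = i ∧ M.upper g = j) i j
  bdryD_subset : M.bdryD ⊆ frontier (⋃ i, M.region i)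
  /-- The Dirichlet boundary has positive measure. -/
  dirichlet : ∃ i T k, M.DirichletFacet i T k

/-- Every element `T` of the subdomain meshes contains a ball (of its own dimension) of radius
`ρ` with `diam T ≤ σ ρ`. -/
def ShapeRegular (σ : ℝ) : Prop :=
  ∀ (i : M.Sub) (T : M.Cell i), 0 < M.dim i → ∃ c ∈ M.plane i, ∃ ρ : ℝ, 0 < ρ ∧
    Metric.closedBall c ρ ∩ (M.plane i : Set (E n)) ⊆ (M.cell i T).closedInterior ∧
    Metric.diam (M.cell i T).closedInterior ≤ σ * ρ

/-! ### Discrete spaces -/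

/-- Elementwise `RT₀` fields on all the subdomains. -/
abbrev Field := ∀ i : M.Sub, M.Cell i → (M.plane i).direction × ℝ

/-- The normal component of an elementwise `RT₀` field on a facet, from inside the element. -/
def flux (v : M.Field) (i : M.Sub) (T : M.Cell i) (k : Fin (M.dim i + 1)) : ℝ :=
  rtFlux (M.cell i T) (v i T) k

/-- The space `V_h`: `RT₀` fields with continuous normal components that vanish on the outer
facets which are not on the Dirichlet boundary. There is no field on subdomains of dimension
zero. -/
def Vh : Submodule ℝ M.Field where
  carrier := {v | (∀ i, M.dim i = 0 → v i = 0) ∧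
    (∀ i T k T' k', M.InteriorPair i T k T' k' → M.flux v i T k + M.flux v i T' k' = 0) ∧
    (∀ i T k, M.Outer i T k → ¬ M.DirichletFacet i T k → M.flux v i T k = 0)}
  add_mem' := by
    rintro v w ⟨hv0, hv1, hv2⟩ ⟨hw0, hw1, hw2⟩
    refine ⟨fun i hi => ?_, fun i T k T' k' h => ?_, fun i T k h h' => ?_⟩
    · rw [Pi.add_apply, hv0 i hi, hw0 i hi, add_zero]
    · have h1 := hv1 i T k T' k' h
      have h2 := hw1 i T k T' k' h
      simp only [flux, Pi.add_apply, rtFlux_add] at *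
      linarith
    · have h1 := hv2 i T k h h'
      have h2 := hw2 i T k h h'
      simp only [flux, Pi.add_apply, rtFlux_add] at *
      linarith
  zero_mem' := by
    refine ⟨fun i hi => rfl, fun i T k T' k' h => ?_, fun i T k h h' => ?_⟩
    · simp [flux, rtFlux_zero]
    · simp [flux, rtFlux_zero]
  smul_mem' := by
    rintro c v ⟨hv0, hv1, hv2⟩
    refine ⟨fun i hi => ?_, fun i T k T' k' h => ?_, fun i T k h h' => ?_⟩
    · rw [Pi.smul_apply, hv0 i hi, smul_zero]
    · have h1 := hv1 i T k T' k' h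
      simp only [flux, Pi.smul_apply, rtFlux_smul] at *
      rw [← mul_add, h1, mul_zero]
    · have h1 := hv2 i T k h h'
      simp only [flux, Pi.smul_apply, rtFlux_smul] at *
      rw [h1, mul_zero]

/-- The space `V_{0h}`: fields of `V_h` with vanishing normal component on the interfaces. -/
def V0h : Submodule ℝ M.Field where
  carrier := {v | v ∈ M.Vh ∧ ∀ i T k, M.OnGamma i T k → M.flux v i T k = 0}
  add_mem' := by
    rintro v w ⟨hv, hv1⟩ ⟨hw, hw1⟩
    refine ⟨M.Vh.add_mem hv hw, fun i T k h => ?_⟩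
    have h1 := hv1 i T k h
    have h2 := hw1 i T k h
    simp only [flux, Pi.add_apply, rtFlux_add] at *
    linarith
  zero_mem' := ⟨M.Vh.zero_mem, fun i T k h => by simp [flux, rtFlux_zero]⟩
  smul_mem' := by
    rintro c v ⟨hv, hv1⟩
    refine ⟨M.Vh.smul_mem c hv, fun i T k h => ?_⟩
    have h1 := hv1 i T k h
    simp only [flux, Pi.smul_apply, rtFlux_smul] at *
    rw [h1, mul_zero]

/-- The mortar space `Λ_h` of piecewise constants on the mortar meshes. -/
abbrev Lh := ∀ g : M.Iface, M.MCell g → ℝ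

/-- The pressure space `Q_h` of piecewise constants on the subdomain meshes. -/
abbrev Qh := ∀ i : M.Sub, M.Cell i → ℝ

/-- The flux space `W_h = V_{0h} × Λ_h`. -/
abbrev Wh := M.V0h × M.Lh

open Classical in
/-- `(u · ν, v · ν)_Γ`. -/
def traceTrace (u v : M.Field) : ℝ :=
  ∑ g, ∑ T, ∑ k, if M.InIface g T k then
    M.flux u _ T k * M.flux v _ T k * (μHE[M.dim (M.lower g)]).real (facet (M.cell _ T) k) else 0

open Classical in
/-- `(μ, v · ν)_Γ`. -/
def mortarTrace (μ : M.Lh) (v : M.Field) : ℝ :=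
  ∑ g, ∑ T, ∑ k, if M.InIface g T k then
    ∑ m, μ g m * M.flux v _ T k *
      (μHE[M.dim (M.lower g)]).real (facet (M.cell _ T) k ∩ (M.mcell g m).closedInterior) else 0

/-- `R` is a discrete extension operator `R_h : Λ_h → V_h`: the normal component of `R μ` is the
`L²(Γ)`-projection of `μ` to the normal traces of `V_h` on the interfaces, and it is zero on the
rest of the boundary. (Its values on interior facets are not prescribed.) -/
def IsExtension (R : M.Lh →ₗ[ℝ] M.Vh) : Prop :=
  ∀ μ : M.Lh, (∀ v ∈ M.Vh, M.traceTrace (R μ) v = M.mortarTrace μ v) ∧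
    ∀ i T k, M.Outer i T k → M.flux (R μ) i T k = 0

/-- The physical parameters: the permeability tensor `K`, constant on each subdomain and acting
on its tangential vectors; the normal permeability `Kν`, measurable and bounded above and below on
each interface; the aperture `γ`, constant on each interface. -/
structure Params where
  K : M.Sub → E n ≃ₗ[ℝ] E n
  K_symm : ∀ i x y, inner ℝ (K i x) y = inner ℝ x (K i y)
  K_pos : ∀ i x, x ≠ 0 → 0 < inner ℝ (K i x) x
  K_tangential : ∀ i, ∀ x ∈ (M.plane i).direction, K i x ∈ (M.plane i).direction
  Kν : M.Iface → E n → ℝ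
  Kν_measurable : ∀ g, Measurable (Kν g)
  Kν_bounds : ∀ g, ∃ c C : ℝ, 0 < c ∧ ∀ x ∈ M.region (M.lower g), c ≤ Kν g x ∧ Kν g x ≤ C
  γ : M.Iface → ℝ
  γ_pos : ∀ g, 0 < γ g

variable {M}

namespace Params

variable (P : M.Params) (R : M.Lh →ₗ[ℝ] M.Vh)

/-- On each subdomain, the ratio of the largest and the smallest eigenvalue of `K` is at most
`κ`. (For scalar permeabilities this holds with `κ = 1`.) -/
def AnisotropyLE (κ : ℝ) : Prop :=
  ∀ i, ∀ x ∈ (M.plane i).direction, ∀ y ∈ (M.plane i).direction, ‖x‖ = 1 → ‖y‖ = 1 →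
    inner ℝ (P.K i x) x ≤ κ * inner ℝ (P.K i y) y

/-- The total flux `v₀ + R_h μ` of `r = [v₀, μ]`. -/
def total (R : M.Lh →ₗ[ℝ] M.Vh) (r : M.Wh) : M.Field := (r.1 : M.Field) + (R r.2 : M.Field)

/-- `(γ Kν⁻¹ lam, μ)_Γ`. -/
def mortarForm (lam μ : M.Lh) : ℝ :=
  ∑ g, ∑ m, ∫ x in (M.mcell g m).closedInterior,
    P.γ g * (P.Kν g x)⁻¹ * lam g m * μ g m ∂μHE[M.dim (M.lower g)]

/-- The bilinear form `a`. -/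
def a (w r : M.Wh) : ℝ :=
  (∑ i, ∑ T, ∫ x in (M.cell i T).closedInterior,
    inner ℝ ((P.K i).symm (rtField (M.cell i T) (total R w i T) x))
      (rtField (M.cell i T) (total R r i T) x) ∂μHE[M.dim i]) + P.mortarForm w.2 r.2

/-- The lumped bilinear form `a^D`. -/
def aD (w r : M.Wh) : ℝ :=
  (∑ i, ∑ T, ∑ k, M.flux (total R w) i T k * M.flux (total R r) i T k *
    ∫ x in (M.cell i T).closedInterior,
      inner ℝ ((P.K i).symm (basisField (M.cell i T) k x)) (basisField (M.cell i T) k x)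
        ∂μHE[M.dim i]) + P.mortarForm w.2 r.2

end Params

/-- `(q, ⟦μ⟧)_Ω`, where the jump `⟦μ⟧` on a subdomain is minus the sum of the values of `μ` on
all the interfaces of which it is the lower-dimensional side. -/
def jumpPairing (q : M.Qh) (μ : M.Lh) : ℝ :=
  -∑ g, ∑ T, ∑ m, q (M.lower g) T * μ g m *
    (μHE[M.dim (M.lower g)]).real ((M.cell _ T).closedInterior ∩ (M.mcell g m).closedInterior)

/-- The bilinear form `b(r, q) = -(q, D · [v₀ + R_h μ, μ])_Ω`, with
`D · [v, μ] = ∇ · v + ⟦μ⟧`. -/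
def b (R : M.Lh →ₗ[ℝ] M.Vh) (r : M.Wh) (q : M.Qh) : ℝ :=
  -((∑ i, ∑ T, q i T * rtDiv (M.dim i) (Params.total R r i T) *
    (μHE[M.dim i]).real (M.cell i T).closedInterior) + jumpPairing q r.2)

namespace Params

variable (P : M.Params) (R : M.Lh →ₗ[ℝ] M.Vh)

/-- `G` is the discrete gradient `D_h : Q_h → W_h`, that is `a^D(D_h p, r) = b(r, p)`. -/
def IsDiscreteGradient (G : M.Qh →ₗ[ℝ] M.Wh) : Prop :=
  ∀ p r, P.aD R (G p) r = b R r p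

/-- The composite bilinear form `a(w, r) + a^D(D_h p, r) + a^D(D_h q, w)`, where `x = (w, p)` and
`y = (r, q)`. -/
def compositeForm (G : M.Qh →ₗ[ℝ] M.Wh) (x y : M.Wh × M.Qh) : ℝ :=
  P.a R x.1 y.1 + P.aD R (G x.2) y.1 + P.aD R (G y.2) x.1

/-- The weighted norm `(‖r‖_a² + ‖D_h q‖_{a^D}²)^{1/2}` of `y = (r, q)`. -/
def weightedNorm (G : M.Qh →ₗ[ℝ] M.Wh) (y : M.Wh × M.Qh) : ℝ :=
  Real.sqrt (P.a R y.1 y.1 + P.aD R (G y.2) (G y.2))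

end Params

end MeshData

end MixedDim

end

/-!
Both forms are sums over the elements and share the mortar term. On an element with `m` facets the
Cauchy–Schwarz inequality for the `m` basis functions gives `a ≤ m a^D`, whatever the mesh. The
converse `a^D ≤ C a` follows by comparing an element with a ball inscribed in it, which costs powers
of `σ` and the anisotropy `κ`; it yields the continuity of the composite form. The stability only
uses `a ≤ (n + 1) a^D`, with the test function `(r + (n + 1)⁻¹ D_h q, -q)`.

The discrete gradient exists because `a^D` is definite. That the weighted norm is a norm amounts to
the injectivity of `D_h`: if `b(r, q) = 0` for all `r`, testing with one interior facet shows that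
the pressures of neighbouring elements have the same sign, so that the pressures of a subdomain all
have the same sign. Testing with the extension of the indicator function of an interface equates a
positive combination of the pressures above it with a positive combination of those below it, so
that `q` vanishes on both sides or on neither. It vanishes next to the Dirichlet boundary, and the
geometry is connected.
-/

noncomputable section

namespace MixedDim

/-! ### Positive semidefinite bilinear forms and saddle point forms -/

section PosSemidef

variable {W : Type*} [AddCommGroup W] [Module ℝ W] {a aD : LinearMap.BilinForm ℝ W}

theorem abs_apply_le_sqrt_mul_sqrt (ha : a.IsPosSemidef) (w r : W) :
    |a w r| ≤ √(a w w) * √(a r r) := by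
  rw [← Real.sqrt_mul (ha.nonneg w)]
  exact Real.abs_le_sqrt (a.apply_sq_le_of_symm ha.nonneg ⟨ha.eq⟩ w r)

theorem two_mul_abs_apply_le (ha : a.IsPosSemidef) (w r : W) :
    2 * |a w r| ≤ a w w + a r r := by
  have hadd := ha.nonneg (w + r)
  have hsub := ha.nonneg (w - r)
  simp only [map_add, map_sub, LinearMap.add_apply, LinearMap.sub_apply, ha.eq r w] at hadd hsub
  rcases abs_cases (a w r) with ⟨habs, -⟩ | ⟨habs, -⟩ <;> linarith

theorem apply_sum_self_le_card_mul_sum (ha : a.IsPosSemidef) {ι : Type*} (s : Finset ι)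
    (y : ι → W) : a (∑ k ∈ s, y k) (∑ k ∈ s, y k) ≤ s.card * ∑ k ∈ s, a (y k) (y k) := by
  calc a (∑ k ∈ s, y k) (∑ k ∈ s, y k) = ∑ k ∈ s, ∑ l ∈ s, a (y l) (y k) := by
        simp only [map_sum, LinearMap.sum_apply]
    _ ≤ ∑ k ∈ s, ∑ l ∈ s, (a (y l) (y l) + a (y k) (y k)) / 2 := by
        gcongr with k _ l _
        linarith [le_abs_self (a (y l) (y k)), two_mul_abs_apply_le ha (y l) (y k)]
    _ = s.card * ∑ k ∈ s, a (y k) (y k) := by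
        simp only [← Finset.sum_div, Finset.sum_add_distrib, Finset.sum_const, nsmul_eq_mul,
          ← Finset.mul_sum]
        ring

theorem abs_saddle_le {C : ℝ} (ha : a.IsPosSemidef) (haD : aD.IsPosSemidef) (hC : 0 ≤ C)
    (hle : ∀ r, aD r r ≤ C * a r r) (w r x y : W) :
    |a w r + aD x r + aD y w| ≤ (1 + 2 * √C) * √(a w w + aD x x) * √(a r r + aD y y) := by
  have sqrt_aD_le (v : W) : √(aD v v) ≤ √C * √(a v v) := by
    rw [← Real.sqrt_mul hC]
    exact Real.sqrt_le_sqrt (hle v)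
  set Nx := √(a w w + aD x x)
  set Ny := √(a r r + aD y y)
  have hw : √(a w w) ≤ Nx := Real.sqrt_le_sqrt (by linarith [haD.nonneg x])
  have hr : √(a r r) ≤ Ny := Real.sqrt_le_sqrt (by linarith [haD.nonneg y])
  have hx : √(aD x x) ≤ Nx := Real.sqrt_le_sqrt (by linarith [ha.nonneg w])
  have hy : √(aD y y) ≤ Ny := Real.sqrt_le_sqrt (by linarith [ha.nonneg r])
  calc |a w r + aD x r + aD y w| ≤ |a w r| + |aD x r| + |aD y w| := abs_add_three _ _ _
    _ ≤ √(a w w) * √(a r r) + √(aD x x) * √(aD r r) + √(aD y y) * √(aD w w) := by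
        gcongr <;> exact abs_apply_le_sqrt_mul_sqrt ‹_› _ _
    _ ≤ Nx * Ny + Nx * (√C * Ny) + Ny * (√C * Nx) := by
        gcongr
        · exact (sqrt_aD_le r).trans (by gcongr)
        · exact (sqrt_aD_le w).trans (by gcongr)
    _ = (1 + 2 * √C) * Nx * Ny := by ring

/-- With `y = D_h q`, this bounds the composite form at `(r, q)`, tested with
`(r + C⁻¹ D_h q, -q)`. -/
theorem le_saddle {C : ℝ} (ha : a.IsPosSemidef) (haD : aD.IsNonneg) (hC : 1 ≤ C)
    (hle : ∀ r, a r r ≤ C * aD r r) (r y : W) :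
    1 / (4 * C) * (√(a (r + C⁻¹ • y) (r + C⁻¹ • y) + aD (-y) (-y)) * √(a r r + aD y y)) ≤
      a (r + C⁻¹ • y) r + aD (-y) r + aD y (r + C⁻¹ • y) := by
  have hr := ha.nonneg r
  have hy := haD.nonneg y
  have hC0 : 0 < C⁻¹ := by positivity
  have hC1 : C⁻¹ ≤ 1 := inv_le_one_of_one_le₀ hC
  have hay : C⁻¹ * (C⁻¹ * a y y) ≤ C⁻¹ * aD y y := by
    gcongr
    exact (inv_mul_le_iff₀ (by positivity)).2 (hle y)
  have cross := two_mul_abs_apply_le ha r (C⁻¹ • y)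
  simp only [map_smul, LinearMap.smul_apply, smul_eq_mul] at cross
  obtain ⟨cross_ge, cross_le⟩ := abs_le.1 (le_refl |C⁻¹ * a r y|)
  have test_norm_le : √(a (r + C⁻¹ • y) (r + C⁻¹ • y) + aD (-y) (-y)) ≤
      2 * √(a r r + aD y y) := by
    rw [show (2 : ℝ) = √(2 ^ 2) from (Real.sqrt_sq (by norm_num)).symm,
      ← Real.sqrt_mul (by norm_num)]
    refine Real.sqrt_le_sqrt ?_
    simp only [map_add, map_smul, map_neg, LinearMap.add_apply, LinearMap.smul_apply,
      LinearMap.neg_apply, smul_eq_mul, ha.eq y r, neg_neg]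
    nlinarith
  calc 1 / (4 * C) * (√(a (r + C⁻¹ • y) (r + C⁻¹ • y) + aD (-y) (-y)) * √(a r r + aD y y))
      ≤ 1 / (4 * C) * (2 * √(a r r + aD y y) * √(a r r + aD y y)) := by gcongr
    _ = C⁻¹ / 2 * (a r r + aD y y) := by
        rw [mul_assoc, Real.mul_self_sqrt (add_nonneg hr hy)]
        field_simp
        norm_num
    _ ≤ a r r + C⁻¹ * a r y + C⁻¹ * aD y y := by nlinarith [hC0]
    _ = a (r + C⁻¹ • y) r + aD (-y) r + aD y (r + C⁻¹ • y) := by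
        simp only [map_add, map_smul, map_neg, LinearMap.add_apply, LinearMap.smul_apply,
          LinearMap.neg_apply, smul_eq_mul, ha.eq y r]
        ring

end PosSemidef

theorem eq_zero_of_sum_mul_eq_zero_of_sign_eq {ι 𝕜 : Type*} [Fintype ι] [Ring 𝕜] [LinearOrder 𝕜]
    [IsStrictOrderedRing 𝕜] {w x : ι → 𝕜} (hw : ∀ i, 0 ≤ w i) {i₀ : ι} (hi₀ : 0 < w i₀)
    (hx : ∀ i j, SignType.sign (x i) = SignType.sign (x j)) (hsum : ∑ i, w i * x i = 0) (i : ι) :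
    x i = 0 := by
  have hsum_abs : ∑ j, w j * |x j| = 0 := by
    calc ∑ j, w j * |x j| = ∑ j, w j * x j * SignType.sign (x i₀) := by
          refine Finset.sum_congr rfl fun j _ => ?_
          rw [hx i₀ j, mul_assoc, self_mul_sign]
      _ = 0 := by rw [← Finset.sum_mul, hsum, zero_mul]
  have hterm := (Finset.sum_eq_zero_iff_of_nonneg
    fun j _ => mul_nonneg (hw j) (abs_nonneg (x j))).1 hsum_abs i₀ (Finset.mem_univ i₀)
  have hx₀ : x i₀ = 0 := abs_eq_zero.1 ((mul_eq_zero.1 hterm).resolve_left hi₀.ne')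
  rw [← sign_eq_zero_iff, hx i i₀, hx₀, sign_zero]

/-- Cauchy–Schwarz for `K` gives `‖y‖⁴ ≤ ⟪K y, y⟫ ⟪K⁻¹ y, y⟫`, so that the hypothesis can be applied
to `y` and `K⁻¹ x`. -/
theorem inner_symm_self_mul_norm_sq_le {V : Type*} [NormedAddCommGroup V] [InnerProductSpace ℝ V]
    {K : V ≃ₗ[ℝ] V} (hK : ∀ x y, inner ℝ (K x) y = inner ℝ x (K y))
    (hK_pos : ∀ x, x ≠ 0 → 0 < inner ℝ (K x) x) {D : Submodule ℝ V}
    (hD : ∀ x ∈ D, K.symm x ∈ D) {κ : ℝ}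
    (hκ : ∀ x ∈ D, ∀ y ∈ D, inner ℝ (K x) x * ‖y‖ ^ 2 ≤ κ * (inner ℝ (K y) y * ‖x‖ ^ 2))
    {x y : V} (hx : x ∈ D) (hy : y ∈ D) :
    inner ℝ (K.symm x) x * ‖y‖ ^ 2 ≤ κ * (inner ℝ (K.symm y) y * ‖x‖ ^ 2) := by
  rcases eq_or_ne x 0 with rfl | hx0
  · simp
  rcases eq_or_ne y 0 with rfl | hy0
  · simp
  have inner_symm_pos {z : V} (hz : z ≠ 0) : 0 < inner ℝ (K.symm z) z := by
    simpa [real_inner_comm z] using hK_pos (K.symm z) (by simpa using hz)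
  have cauchy_schwarz : inner ℝ (K.symm x) x ^ 2 ≤ ‖K.symm x‖ ^ 2 * ‖x‖ ^ 2 := by
    rw [← mul_pow]
    exact sq_le_sq' (neg_le_of_abs_le (abs_real_inner_le_norm _ _)) (real_inner_le_norm _ _)
  have cauchy_schwarz_K : (‖y‖ ^ 2) ^ 2 ≤ inner ℝ (K y) y * inner ℝ (K.symm y) y := by
    have h := LinearMap.BilinForm.apply_sq_le_of_symm (innerₗ V ∘ₗ K.toLinearMap)
      (fun z => (eq_or_ne z 0).elim (fun h => by simp [h]) fun h => (hK_pos z h).le)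
      ⟨fun z z' => by simp [hK z, real_inner_comm z]⟩ y (K.symm y)
    simpa [hK y, real_inner_comm y] using h
  have hκ' := hκ y hy (K.symm x) (hD x hx)
  rw [K.apply_symm_apply, real_inner_comm (K.symm x) x] at hκ'
  have hpos : 0 < inner ℝ (K.symm x) x * ‖y‖ ^ 2 :=
    mul_pos (inner_symm_pos hx0) (by positivity)
  refine le_of_mul_le_mul_left ?_ hpos
  calc inner ℝ (K.symm x) x * ‖y‖ ^ 2 * (inner ℝ (K.symm x) x * ‖y‖ ^ 2)
      = inner ℝ (K.symm x) x ^ 2 * (‖y‖ ^ 2) ^ 2 := by ring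
    _ ≤ ‖K.symm x‖ ^ 2 * ‖x‖ ^ 2 * (inner ℝ (K y) y * inner ℝ (K.symm y) y) := by gcongr
    _ = inner ℝ (K y) y * ‖K.symm x‖ ^ 2 * (‖x‖ ^ 2 * inner ℝ (K.symm y) y) := by ring
    _ ≤ κ * (inner ℝ (K.symm x) x * ‖y‖ ^ 2) * (‖x‖ ^ 2 * inner ℝ (K.symm y) y) :=
        mul_le_mul_of_nonneg_right hκ' (mul_nonneg (sq_nonneg _) (inner_symm_pos hy0).le)
    _ = inner ℝ (K.symm x) x * ‖y‖ ^ 2 * (κ * (inner ℝ (K.symm y) y * ‖x‖ ^ 2)) := by ring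

/-! ### Integrals over balls and over products -/

theorem integral_mul_integral_le_of_ae_le {X Y : Type*} [MeasurableSpace X] [MeasurableSpace Y]
    {μ : Measure X} {ν : Measure Y} {F₁ F₂ : X → ℝ} {G₁ G₂ : Y → ℝ} (hF₁ : Integrable F₁ μ)
    (hF₂ : Integrable F₂ μ) (hG₁ : Integrable G₁ ν) (hG₂ : Integrable G₂ ν) {κ : ℝ}
    (h : ∀ᵐ y ∂ν, ∀ᵐ x ∂μ, F₁ x * G₂ y ≤ κ * (G₁ y * F₂ x)) :
    (∫ x, F₁ x ∂μ) * (∫ y, G₂ y ∂ν) ≤ κ * ((∫ y, G₁ y ∂ν) * ∫ x, F₂ x ∂μ) := by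
  rw [← integral_const_mul, ← integral_mul_const, ← integral_const_mul]
  refine integral_mono_ae (hG₂.const_mul _) ((hG₁.mul_const _).const_mul _) ?_
  filter_upwards [h] with y hy
  rw [← integral_mul_const, ← integral_const_mul, ← integral_const_mul]
  exact integral_mono_ae (hF₁.mul_const _) ((hF₂.const_mul _).const_mul _) hy

section BallIntegral

open Metric (closedBall)

variable {D : Type*} [NormedAddCommGroup D] [InnerProductSpace ℝ D] [FiniteDimensional ℝ D]
  [MeasurableSpace D] [BorelSpace D]

theorem volume_real_closedBall_mul {r ρ : ℝ} (hr : 0 ≤ r) (hρ : 0 ≤ ρ) :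
    volume.real (closedBall (0 : D) (r * ρ)) =
      r ^ Module.finrank ℝ D * volume.real (closedBall (0 : D) ρ) := by
  rw [Measure.addHaar_real_closedBall volume _ (mul_nonneg hr hρ),
    Measure.addHaar_real_closedBall volume _ hρ, mul_pow, mul_assoc]

theorem integrableOn_closedBall {f : D → ℝ} (hf : Continuous f) (ρ : ℝ) :
    IntegrableOn f (closedBall 0 ρ) :=
  hf.continuousOn.integrableOn_compact (isCompact_closedBall _ _)

/-- At least half of the ball lies outside the concentric ball of half the radius. -/
theorem le_integral_norm_sq_closedBall [Nontrivial D] {ρ : ℝ} (hρ : 0 ≤ ρ) :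
    volume.real (closedBall (0 : D) ρ) * (ρ ^ 2 / 8) ≤ ∫ z in closedBall (0 : D) ρ, ‖z‖ ^ 2 := by
  set B := closedBall (0 : D) ρ
  set B' := closedBall (0 : D) (1 / 2 * ρ)
  have volume_B'_le : volume.real B' ≤ 1 / 2 * volume.real B := by
    rw [volume_real_closedBall_mul (by norm_num) hρ]
    gcongr
    exact pow_le_of_le_one (by norm_num) (by norm_num) Module.finrank_pos.ne'
  have volume_sdiff : volume.real (B \ B') = volume.real B - volume.real B' :=
    measureReal_sdiff (Metric.closedBall_subset_closedBall (by linarith))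
      measurableSet_closedBall measure_closedBall_lt_top.ne
  have hint : IntegrableOn (fun z : D => ‖z‖ ^ 2) B := integrableOn_closedBall (by fun_prop) ρ
  calc volume.real B * (ρ ^ 2 / 8) ≤ volume.real (B \ B') * (1 / 2 * ρ) ^ 2 := by
        nlinarith [mul_le_mul_of_nonneg_right volume_B'_le (sq_nonneg ρ)]
    _ = ∫ _ in B \ B', (1 / 2 * ρ) ^ 2 := by rw [setIntegral_const, smul_eq_mul]
    _ ≤ ∫ z in B \ B', ‖z‖ ^ 2 := by
        refine setIntegral_mono_on
          (integrableOn_const (measure_ne_top_of_subset Set.sdiff_subset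
            measure_closedBall_lt_top.ne))
          (hint.mono_set Set.sdiff_subset)
          (measurableSet_closedBall.diff measurableSet_closedBall) fun z hz => ?_
        have hz' : 1 / 2 * ρ < ‖z‖ := by simpa [B'] using hz.2
        gcongr
    _ ≤ ∫ z in B, ‖z‖ ^ 2 :=
        setIntegral_mono_set hint (ae_of_all _ fun z => by positivity)
          (Filter.Eventually.of_forall Set.sdiff_subset)

/-- The cross terms cancel by the symmetry `z ↦ -z` of the ball. -/
theorem integral_norm_add_smul_sq_closedBall (a : D) (b ρ : ℝ) :
    ∫ z in closedBall (0 : D) ρ, ‖a + b • z‖ ^ 2 =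
      volume.real (closedBall (0 : D) ρ) * ‖a‖ ^ 2 +
        b ^ 2 * ∫ z in closedBall (0 : D) ρ, ‖z‖ ^ 2 := by
  set B := closedBall (0 : D) ρ
  have reflection : ∫ z in B, ‖a - b • z‖ ^ 2 = ∫ z in B, ‖a + b • z‖ ^ 2 := by
    have h := (Measure.measurePreserving_neg (volume : Measure D)).setIntegral_preimage_emb
      (MeasurableEquiv.neg D).measurableEmbedding (fun z => ‖a + b • z‖ ^ 2) B
    simpa [B, sub_eq_add_neg] using h
  have parallelogram (z : D) :
      ‖a + b • z‖ ^ 2 + ‖a - b • z‖ ^ 2 = 2 * ‖a‖ ^ 2 + 2 * b ^ 2 * ‖z‖ ^ 2 := by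
    rw [norm_add_sq_real, norm_sub_sq_real, norm_smul, mul_pow, Real.norm_eq_abs, sq_abs]
    ring
  have integral_parallelogram : (∫ z in B, ‖a + b • z‖ ^ 2) + ∫ z in B, ‖a - b • z‖ ^ 2 =
      2 * (volume.real B * ‖a‖ ^ 2) + 2 * b ^ 2 * ∫ z in B, ‖z‖ ^ 2 := by
    rw [← integral_add (integrableOn_closedBall (by fun_prop) ρ)
      (integrableOn_closedBall (by fun_prop) ρ)]
    simp_rw [parallelogram]
    rw [integral_add (integrableOn_closedBall (by fun_prop) ρ)
      (integrableOn_closedBall (by fun_prop) ρ), setIntegral_const, integral_const_mul,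
      smul_eq_mul]
    ring
  linarith

theorem le_integral_norm_add_smul_sq_closedBall [Nontrivial D] {ρ : ℝ} (hρ : 0 ≤ ρ) (a : D)
    (b : ℝ) :
    volume.real (closedBall (0 : D) ρ) * (‖a‖ ^ 2 + b ^ 2 * ρ ^ 2 / 8) ≤
      ∫ z in closedBall (0 : D) ρ, ‖a + b • z‖ ^ 2 := by
  rw [integral_norm_add_smul_sq_closedBall]
  nlinarith [mul_le_mul_of_nonneg_left (le_integral_norm_sq_closedBall (D := D) hρ) (sq_nonneg b)]

end BallIntegral

/-! ### The lowest-order Raviart–Thomas element -/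

section Simplex

variable {n d : ℕ} (s : Affine.Simplex ℝ (E n) d)

theorem univ_erase_nonempty (hd : 0 < d) (k : Fin (d + 1)) :
    ((Finset.univ : Finset (Fin (d + 1))).erase k).Nonempty := by
  rw [← Finset.card_pos, Finset.card_erase_of_mem (Finset.mem_univ _)]
  simpa using hd

theorem facetBarycentre_mem_facet (hd : 0 < d) (k : Fin (d + 1)) :
    facetBarycentre s k ∈ facet s k := by
  have sum_weights := Finset.sum_centroidWeights_eq_one_of_nonempty ℝ _ (univ_erase_nonempty hd k)
  rw [facetBarycentre, Finset.centroid_def, affineCombination_eq_centerMass sum_weights]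
  exact Finset.centerMass_mem_convexHull _ (fun _ _ => by simp [Finset.centroidWeights])
    (by rw [sum_weights]; exact one_pos)
    fun l hl => Set.mem_image_of_mem _ (by simpa using Finset.ne_of_mem_erase hl)

theorem facet_subset_affineSpan (k : Fin (d + 1)) :
    facet s k ⊆ affineSpan ℝ (s.points '' {k}ᶜ) :=
  convexHull_subset_affineSpan _

theorem facet_subset_closedInterior (k : Fin (d + 1)) : facet s k ⊆ s.closedInterior := by
  rw [← Affine.Simplex.convexHull_eq_closedInterior]
  exact convexHull_mono (Set.image_subset_range _ _)

theorem facetBarycentre_sub_mem_vectorSpan (hd : 0 < d) {k l : Fin (d + 1)} (hkl : l ≠ k) :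
    facetBarycentre s k - s.points l ∈ vectorSpan ℝ (s.points '' {k}ᶜ) := by
  rw [← direction_affineSpan]
  exact AffineSubspace.vsub_mem_direction
    (facet_subset_affineSpan s k (facetBarycentre_mem_facet s hd k))
    (subset_affineSpan ℝ _ (Set.mem_image_of_mem _ hkl))

theorem altitudeVec_mem_orthogonal (k : Fin (d + 1)) :
    altitudeVec s k ∈ (vectorSpan ℝ (s.points '' {k}ᶜ))ᗮ :=
  Submodule.starProjection_apply_mem _ _

theorem altitudeVec_ne_zero (hd : 0 < d) (k : Fin (d + 1)) : altitudeVec s k ≠ 0 := by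
  intro h
  rw [altitudeVec, Submodule.starProjection_apply_eq_zero_iff, Submodule.orthogonal_orthogonal,
    ← direction_affineSpan] at h
  have point_mem : s.points k ∈ affineSpan ℝ (s.points '' {k}ᶜ) := by
    simpa using AffineSubspace.vadd_mem_of_mem_direction (Submodule.neg_mem _ h)
      (facet_subset_affineSpan s k (facetBarycentre_mem_facet s hd k))
  have point_notMem := s.independent.notMem_affineSpan_sdiff k Set.univ
  rw [← Set.compl_eq_univ_sdiff] at point_notMem
  exact point_notMem point_mem

theorem height_pos (hd : 0 < d) (k : Fin (d + 1)) : 0 < height s k :=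
  norm_pos_iff.2 (altitudeVec_ne_zero s hd k)

theorem norm_outerNormal (hd : 0 < d) (k : Fin (d + 1)) : ‖outerNormal s k‖ = 1 := by
  have h := height_pos s hd k
  rw [outerNormal, norm_smul, norm_inv, Real.norm_of_nonneg h.le]
  exact inv_mul_cancel₀ h.ne'

theorem inner_outerNormal_eq_zero {k : Fin (d + 1)} {x : E n}
    (hx : x ∈ vectorSpan ℝ (s.points '' {k}ᶜ)) : inner ℝ x (outerNormal s k) = 0 := by
  rw [outerNormal, inner_smul_right, altitudeVec_mem_orthogonal s k x hx, mul_zero]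

theorem inner_facetBarycentre_sub_self (hd : 0 < d) (k : Fin (d + 1)) :
    inner ℝ (facetBarycentre s k - s.points k) (outerNormal s k) = height s k := by
  have inner_altitudeVec : inner ℝ (facetBarycentre s k - s.points k) (altitudeVec s k) =
      height s k * height s k := by
    rw [height, ← real_inner_self_eq_norm_mul_norm]
    conv_rhs => rw [altitudeVec, Submodule.inner_starProjection_left_eq_right, ← altitudeVec,
      Submodule.starProjection_eq_self_iff.2 (altitudeVec_mem_orthogonal s k)]
  rw [outerNormal, inner_smul_right, inner_altitudeVec,
    inv_mul_cancel_left₀ (height_pos s hd k).ne']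

theorem inner_points_sub (hd : 0 < d) {k l : Fin (d + 1)} (hkl : l ≠ k) :
    inner ℝ (s.points l - s.points k) (outerNormal s k) = height s k := by
  rw [← sub_sub_sub_cancel_left _ _ (facetBarycentre s k), inner_sub_left,
    inner_facetBarycentre_sub_self s hd,
    inner_outerNormal_eq_zero s (facetBarycentre_sub_mem_vectorSpan s hd hkl), sub_zero]

theorem inner_sub_mem_Icc (hd : 0 < d) (k : Fin (d + 1)) {x : E n} (hx : x ∈ s.closedInterior) :
    inner ℝ (x - s.points k) (outerNormal s k) ∈ Set.Icc 0 (height s k) := by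
  rw [← Affine.Simplex.convexHull_eq_closedInterior] at hx
  have convex_slab : Convex ℝ {x : E n | inner ℝ (x - s.points k) (outerNormal s k) ∈
      Set.Icc 0 (height s k)} := by
    have slab_eq : {x : E n | inner ℝ (x - s.points k) (outerNormal s k) ∈
        Set.Icc 0 (height s k)} = (innerₗ (E n)).flip (outerNormal s k) ⁻¹' Set.Icc
          (inner ℝ (s.points k) (outerNormal s k))
          (height s k + inner ℝ (s.points k) (outerNormal s k)) := by
      ext x
      simp [inner_sub_left, real_inner_comm x]
    rw [slab_eq]
    exact (convex_Icc _ _).linear_preimage _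
  refine convexHull_min ?_ convex_slab hx
  rintro _ ⟨l, rfl⟩
  have h := (height_pos s hd k).le
  rcases eq_or_ne l k with rfl | hl
  · simpa using h
  · simpa [inner_points_sub s hd hl] using h

/-- The value at the point `x` of a local `RT₀` field, as a linear map. -/
def rtEval (D : Submodule ℝ (E n)) (x : E n) : D × ℝ →ₗ[ℝ] E n :=
  D.subtype ∘ₗ LinearMap.fst ℝ D ℝ +
    LinearMap.toSpanSingleton ℝ (E n) (x - barycentre s) ∘ₗ LinearMap.snd ℝ D ℝ

/-- The normal components of a local `RT₀` field, as a linear map. -/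
def rtFluxMap (D : Submodule ℝ (E n)) : D × ℝ →ₗ[ℝ] Fin (d + 1) → ℝ where
  toFun v := rtFlux s v
  map_add' v w := funext fun k => rtFlux_add s v w k
  map_smul' c v := funext fun k => rtFlux_smul s c v k

section

variable {D : Submodule ℝ (E n)}

theorem rtField_eq_rtEval (v : D × ℝ) (x : E n) : rtField s v x = rtEval s D x v := rfl

theorem rtFlux_eq_rtFluxMap (v : D × ℝ) : rtFlux s v = rtFluxMap s D v := rfl

theorem rtField_sub_rtField (v : D × ℝ) (x y : E n) :
    rtField s v x - rtField s v y = v.2 • (x - y) := by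
  simp only [rtField, smul_sub]
  abel

theorem continuous_rtField (v : D × ℝ) : Continuous (rtField s v) := by
  unfold rtField
  fun_prop

end

theorem continuous_basisField (k : Fin (d + 1)) : Continuous (basisField s k) := by
  unfold basisField
  fun_prop

variable {s} {A : AffineSubspace ℝ (E n)} (hA : affineSpan ℝ (Set.range s.points) = A)

include hA

theorem closedInterior_subset_plane : s.closedInterior ⊆ A := fun _ hx =>
  hA ▸ Affine.Simplex.closedInterior_subset_affineSpan hx

theorem point_mem_plane (k : Fin (d + 1)) : s.points k ∈ A :=
  closedInterior_subset_plane hA (s.point_mem_closedInterior k)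

theorem finrank_direction : Module.finrank ℝ A.direction = d := by
  rw [← hA, direction_affineSpan]
  exact s.independent.finrank_vectorSpan (by simp)

theorem dim_le : d ≤ n := by
  have h := Submodule.finrank_le A.direction
  rwa [finrank_direction hA, finrank_euclideanSpace_fin] at h

theorem barycentre_mem_plane : barycentre s ∈ A :=
  hA ▸ centroid_mem_affineSpan_of_nonempty ℝ _ Finset.univ_nonempty

theorem outerNormal_mem_direction (hd : 0 < d) (k : Fin (d + 1)) :
    outerNormal s k ∈ A.direction := by
  have vectorSpan_le : vectorSpan ℝ (s.points '' {k}ᶜ) ≤ A.direction := by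
    rw [← hA, direction_affineSpan]
    exact vectorSpan_mono ℝ (Set.image_subset_range _ _)
  have facetBarycentre_mem : facetBarycentre s k ∈ A := closedInterior_subset_plane hA
    (facet_subset_closedInterior s k (facetBarycentre_mem_facet s hd k))
  rw [outerNormal, altitudeVec, Submodule.starProjection_orthogonal_val]
  exact Submodule.smul_mem _ _ (Submodule.sub_mem _
    (AffineSubspace.vsub_mem_direction facetBarycentre_mem (point_mem_plane hA k))
    (vectorSpan_le (Submodule.starProjection_apply_mem _ _)))

/-- The `RT₀` basis function of the facet `k`, in the form `x ↦ a + b (x - x_s)`. -/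
def basisCoeff (k : Fin (d + 1)) : A.direction × ℝ :=
  (⟨(height s k)⁻¹ • (barycentre s - s.points k), Submodule.smul_mem _ _
    (AffineSubspace.vsub_mem_direction (barycentre_mem_plane hA) (point_mem_plane hA k))⟩,
    (height s k)⁻¹)

theorem rtField_basisCoeff (k : Fin (d + 1)) (x : E n) :
    rtField s (basisCoeff hA k) x = basisField s k x := by
  simp only [rtField, basisCoeff, basisField, ← smul_add]
  congr 1
  abel

theorem rtFlux_basisCoeff (hd : 0 < d) (k l : Fin (d + 1)) :
    rtFlux s (basisCoeff hA k) l = if l = k then 1 else 0 := by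
  rw [rtFlux, rtField_basisCoeff, basisField, inner_smul_left]
  split_ifs with h
  · subst h
    rw [inner_facetBarycentre_sub_self s hd]
    exact inv_mul_cancel₀ (height_pos s hd l).ne'
  · rw [inner_outerNormal_eq_zero s (facetBarycentre_sub_mem_vectorSpan s hd (Ne.symm h)), mul_zero]

/-- The `RT₀` field with prescribed normal components. -/
def ofFlux (c : Fin (d + 1) → ℝ) : A.direction × ℝ := ∑ k, c k • basisCoeff hA k

theorem rtFlux_ofFlux (hd : 0 < d) (c : Fin (d + 1) → ℝ) : rtFlux s (ofFlux hA c) = c := by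
  funext l
  rw [rtFlux_eq_rtFluxMap, ofFlux, map_sum, Finset.sum_apply]
  simp_rw [map_smul, Pi.smul_apply, ← rtFlux_eq_rtFluxMap, rtFlux_basisCoeff hA hd, smul_eq_mul,
    mul_ite, mul_one, mul_zero, Finset.sum_ite_eq, Finset.mem_univ, if_true]

theorem rtFlux_injective (hd : 0 < d) :
    Function.Injective fun v : A.direction × ℝ => rtFlux s v := by
  have hfin : Module.finrank ℝ (A.direction × ℝ) = Module.finrank ℝ (Fin (d + 1) → ℝ) := by
    rw [Module.finrank_prod, finrank_direction hA, Module.finrank_self, Module.finrank_fin_fun]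
  exact (LinearMap.injective_iff_surjective_of_finrank_eq_finrank
    (f := rtFluxMap s A.direction) hfin).2 fun c => ⟨ofFlux hA c, rtFlux_ofFlux hA hd c⟩

theorem ofFlux_rtFlux (hd : 0 < d) (v : A.direction × ℝ) : ofFlux hA (rtFlux s v) = v :=
  rtFlux_injective hA hd (rtFlux_ofFlux hA hd _)

theorem rtField_eq_sum (hd : 0 < d) (v : A.direction × ℝ) (x : E n) :
    rtField s v x = ∑ k, rtFlux s v k • basisField s k x := by
  conv_lhs => rw [← ofFlux_rtFlux hA hd v, rtField_eq_rtEval, ofFlux, map_sum]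
  simp_rw [map_smul, ← rtField_eq_rtEval, rtField_basisCoeff]

theorem rtDiv_eq_sum (hd : 0 < d) (v : A.direction × ℝ) :
    rtDiv d v = ∑ k, rtFlux s v k * (d / height s k) := by
  conv_lhs => rw [← ofFlux_rtFlux hA hd v, rtDiv, ofFlux, Prod.snd_sum, Finset.mul_sum]
  simp_rw [basisCoeff, Prod.smul_mk, smul_eq_mul, div_eq_mul_inv, mul_left_comm]

theorem rtField_mem_direction (v : A.direction × ℝ) {x : E n} (hx : x ∈ A) :
    rtField s v x ∈ A.direction :=
  Submodule.add_mem _ v.1.2 (Submodule.smul_mem _ _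
    (AffineSubspace.vsub_mem_direction hx (barycentre_mem_plane hA)))

theorem basisField_mem_direction (k : Fin (d + 1)) {x : E n} (hx : x ∈ A) :
    basisField s k x ∈ A.direction :=
  Submodule.smul_mem _ _ (AffineSubspace.vsub_mem_direction hx (point_mem_plane hA k))

end Simplex

/-! ### The measure of a simplex -/

section Measure

open Metric (closedBall diam)

variable {n d : ℕ} {s : Affine.Simplex ℝ (E n) d} {A : AffineSubspace ℝ (E n)} {c : E n}

/-- The isometric parametrization `z ↦ z + c` of an affine subspace through `c` by its
direction. -/
def chart (A : AffineSubspace ℝ (E n)) (c : E n) (z : A.direction) : E n := (z : E n) + c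

theorem isometry_chart (c : E n) : Isometry (chart A c) :=
  (isometry_add_right c).comp isometry_subtype_coe

theorem measurableEmbedding_chart (c : E n) : MeasurableEmbedding (chart A c) :=
  (isometry_chart c).isClosedEmbedding.measurableEmbedding

theorem chart_mem (hc : c ∈ A) (z : A.direction) : chart A c z ∈ A :=
  AffineSubspace.vadd_mem_of_mem_direction z.2 hc

theorem range_chart (hc : c ∈ A) : Set.range (chart A c) = A :=
  (Set.range_subset_iff.2 (chart_mem hc)).antisymm fun x hx =>
    ⟨⟨x - c, AffineSubspace.vsub_mem_direction hx hc⟩, sub_add_cancel x c⟩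

theorem map_chart (hA : affineSpan ℝ (Set.range s.points) = A) (hc : c ∈ A) :
    (volume : Measure A.direction).map (chart A c) = (μHE[d]).restrict (A : Set (E n)) := by
  rw [← range_chart hc, ← (isometry_chart c).map_euclideanHausdorffMeasure,
    ← InnerProductSpace.euclideanHausdorffMeasure_eq_volume, finrank_direction hA]

theorem setIntegral_eq_setIntegral_chart (hA : affineSpan ℝ (Set.range s.points) = A)
    (hc : c ∈ A) {S : Set (E n)} (hS : S ⊆ A) (f : E n → ℝ) :
    ∫ x in S, f x ∂μHE[d] = ∫ z in chart A c ⁻¹' S, f (chart A c z) := by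
  rw [← (measurableEmbedding_chart c).setIntegral_map, map_chart hA hc,
    Measure.restrict_restrict_of_subset hS]

theorem measure_eq_volume_chart_preimage (hA : affineSpan ℝ (Set.range s.points) = A)
    (hc : c ∈ A) {S : Set (E n)} (hS : S ⊆ A) : μHE[d] S = volume (chart A c ⁻¹' S) := by
  rw [← (measurableEmbedding_chart c).map_apply, map_chart hA hc, Measure.restrict_eq_self _ hS]

/-- The ball of radius `ρ` around `c` within the affine subspace `A` is contained in the simplex
`s`; in the applications `A` is the affine hull of `s`. -/
structure IsInscribedBall (s : Affine.Simplex ℝ (E n) d) (A : AffineSubspace ℝ (E n)) (c : E n)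
    (ρ : ℝ) : Prop where
  pos : 0 < ρ
  center_mem : c ∈ A
  subset : closedBall c ρ ∩ A ⊆ s.closedInterior

theorem IsInscribedBall.center_mem_closedInterior {ρ : ℝ} (h : IsInscribedBall s A c ρ) :
    c ∈ s.closedInterior :=
  h.subset ⟨Metric.mem_closedBall_self h.pos.le, h.center_mem⟩

theorem IsInscribedBall.closedBall_subset_chart_preimage {ρ : ℝ} (h : IsInscribedBall s A c ρ) :
    closedBall 0 ρ ⊆ chart A c ⁻¹' s.closedInterior := by
  intro z hz
  refine h.subset ⟨?_, chart_mem h.center_mem z⟩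
  rw [mem_closedBall_zero_iff] at hz
  simpa [chart] using hz

theorem IsInscribedBall.volume_real_closedBall_pos {ρ : ℝ} (h : IsInscribedBall s A c ρ) :
    0 < volume.real (closedBall (0 : A.direction) ρ) :=
  ENNReal.toReal_pos (Metric.measure_closedBall_pos _ _ h.pos).ne' measure_closedBall_lt_top.ne

variable (s) in
theorem exists_isInscribedBall :
    ∃ c ρ, IsInscribedBall s (affineSpan ℝ (Set.range s.points)) c ρ := by
  have convex_closedInterior : Convex ℝ s.closedInterior := by
    rw [← Affine.Simplex.convexHull_eq_closedInterior]
    exact convex_convexHull _ _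
  have span_closedInterior :
      affineSpan ℝ s.closedInterior = affineSpan ℝ (Set.range s.points) := by
    rw [← Affine.Simplex.convexHull_eq_closedInterior, affineSpan_convexHull]
  obtain ⟨_, c, hc, rfl⟩ := s.nonempty_closedInterior.intrinsicInterior convex_closedInterior
  rw [mem_interior_iff_mem_nhds, Metric.nhds_basis_closedBall.mem_iff] at hc
  obtain ⟨ρ, hρ, hball⟩ := hc
  refine ⟨c, ρ, hρ, span_closedInterior ▸ c.2, ?_⟩
  rintro x ⟨hx, hx_mem⟩
  exact hball (a := ⟨x, span_closedInterior.symm ▸ hx_mem⟩) hx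

variable (s)

theorem measure_closedInterior_lt_top : μHE[d] s.closedInterior < ⊤ := by
  rw [measure_eq_volume_chart_preimage rfl (point_mem_plane (s := s) rfl 0)
    Affine.Simplex.closedInterior_subset_affineSpan]
  exact ((isometry_chart _).isClosedEmbedding.isCompact_preimage
    s.isCompact_closedInterior).measure_lt_top

theorem measure_closedInterior_pos : 0 < μHE[d] s.closedInterior := by
  obtain ⟨c, ρ, h⟩ := exists_isInscribedBall s
  rw [measure_eq_volume_chart_preimage rfl h.center_mem
    Affine.Simplex.closedInterior_subset_affineSpan]
  exact (Metric.measure_closedBall_pos _ _ h.pos).trans_le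
    (measure_mono h.closedBall_subset_chart_preimage)

theorem measureReal_closedInterior_pos : 0 < (μHE[d]).real s.closedInterior :=
  ENNReal.toReal_pos (measure_closedInterior_pos s).ne' (measure_closedInterior_lt_top s).ne

theorem integrableOn_closedInterior {f : E n → ℝ} (hf : Continuous f) :
    IntegrableOn f s.closedInterior μHE[d] := by
  obtain ⟨C, hC⟩ := s.isCompact_closedInterior.exists_bound_of_continuousOn hf.continuousOn
  exact Measure.integrableOn_of_bounded (measure_closedInterior_lt_top s).ne
    hf.aestronglyMeasurable (ae_restrict_of_forall_mem s.isClosed_closedInterior.measurableSet hC)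

theorem facet_eq_closedInterior (s : Affine.Simplex ℝ (E n) (d + 1)) (k : Fin (d + 1 + 1)) :
    facet s k = (s.faceOpposite k).closedInterior := by
  rw [facet, ← Affine.Simplex.convexHull_eq_closedInterior, s.range_faceOpposite_points]

theorem measure_facet_pos {d' : ℕ} (hd : d = d' + 1) (k : Fin (d + 1)) :
    0 < μHE[d'] (facet s k) := by
  subst hd
  rw [facet_eq_closedInterior]
  exact measure_closedInterior_pos (s.faceOpposite k)

theorem measure_facet_lt_top {d' : ℕ} (hd : d = d' + 1) (k : Fin (d + 1)) :
    μHE[d'] (facet s k) < ⊤ := by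
  subst hd
  rw [facet_eq_closedInterior]
  exact measure_closedInterior_lt_top (s.faceOpposite k)

theorem measureReal_facet_pos {d' : ℕ} (hd : d = d' + 1) (k : Fin (d + 1)) :
    0 < (μHE[d']).real (facet s k) :=
  ENNReal.toReal_pos (measure_facet_pos s hd k).ne' (measure_facet_lt_top s hd k).ne

end Measure

/-! ### Scaling estimates for Raviart–Thomas fields on shape regular simplices -/

section Scaling

open Metric (closedBall diam)

variable {n d : ℕ} {s : Affine.Simplex ℝ (E n) d} {A : AffineSubspace ℝ (E n)} {c : E n} {ρ σ : ℝ}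

theorem norm_sub_le_of_diam_le (hdiam : diam s.closedInterior ≤ σ * ρ) {x y : E n}
    (hx : x ∈ s.closedInterior) (hy : y ∈ s.closedInterior) : ‖x - y‖ ≤ σ * ρ := by
  rw [← dist_eq_norm]
  exact (Metric.dist_le_diam_of_mem s.isCompact_closedInterior.isBounded hx hy).trans hdiam

theorem abs_rtFlux_le (hd : 0 < d) (hc : c ∈ s.closedInterior)
    (hdiam : diam s.closedInterior ≤ σ * ρ) {D : Submodule ℝ (E n)} (v : D × ℝ)
    (k : Fin (d + 1)) : |rtFlux s v k| ≤ ‖rtField s v c‖ + |v.2| * (σ * ρ) := by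
  have facetBarycentre_mem :=
    facet_subset_closedInterior s k (facetBarycentre_mem_facet s hd k)
  calc |rtFlux s v k| ≤ ‖rtField s v (facetBarycentre s k)‖ := by
        simpa [rtFlux, norm_outerNormal s hd] using abs_real_inner_le_norm _ (outerNormal s k)
    _ = ‖rtField s v c + v.2 • (facetBarycentre s k - c)‖ := by
        rw [← rtField_sub_rtField, add_sub_cancel]
    _ ≤ ‖rtField s v c‖ + |v.2| * ‖facetBarycentre s k - c‖ := by
        simpa [norm_smul] using norm_add_le (rtField s v c) (v.2 • (facetBarycentre s k - c))
    _ ≤ ‖rtField s v c‖ + |v.2| * (σ * ρ) := by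
        gcongr
        exact norm_sub_le_of_diam_le hdiam facetBarycentre_mem hc

namespace IsInscribedBall

variable (h : IsInscribedBall s A c ρ) (hA : affineSpan ℝ (Set.range s.points) = A)

include h

theorem nonneg_of_diam_le (hdiam : diam s.closedInterior ≤ σ * ρ) : 0 ≤ σ :=
  nonneg_of_mul_nonneg_left (Metric.diam_nonneg.trans hdiam) h.pos

include hA

theorem le_height (hd : 0 < d) (k : Fin (d + 1)) : ρ ≤ height s k := by
  have hν := norm_outerNormal s hd k
  have shifted_mem : ρ • outerNormal s k + c ∈ s.closedInterior := by
    refine h.subset ⟨?_, AffineSubspace.vadd_mem_of_mem_direction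
      (Submodule.smul_mem _ _ (outerNormal_mem_direction hA hd k)) h.center_mem⟩
    simp [norm_smul, hν, abs_of_pos h.pos]
  have center_depth := (inner_sub_mem_Icc s hd k h.center_mem_closedInterior).1
  have shifted_depth := (inner_sub_mem_Icc s hd k shifted_mem).2
  rw [add_sub_assoc, inner_add_left, inner_smul_left, real_inner_self_eq_norm_sq, hν,
    conj_trivial] at shifted_depth
  linarith

theorem le_integral_norm_rtField_sq (hd : 0 < d) (v : A.direction × ℝ) :
    volume.real (closedBall (0 : A.direction) ρ) *
        (‖rtField s v c‖ ^ 2 + v.2 ^ 2 * ρ ^ 2 / 8) ≤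
      ∫ x in s.closedInterior, ‖rtField s v x‖ ^ 2 ∂μHE[d] := by
  have : Nontrivial A.direction :=
    Module.nontrivial_of_finrank_pos (R := ℝ) (by rwa [finrank_direction hA])
  set a : A.direction := ⟨rtField s v c, rtField_mem_direction hA v h.center_mem⟩
  have field_chart (z : A.direction) : ‖rtField s v (chart A c z)‖ = ‖a + v.2 • z‖ := by
    rw [← Submodule.norm_coe (a + v.2 • z), Submodule.coe_add, Submodule.coe_smul,
      sub_eq_iff_eq_add'.1 (rtField_sub_rtField s v (chart A c z) c), chart, add_sub_cancel_right]
  rw [setIntegral_eq_setIntegral_chart hA h.center_mem (closedInterior_subset_plane hA)]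
  simp_rw [field_chart]
  refine (le_integral_norm_add_smul_sq_closedBall h.pos.le a v.2).trans ?_
  have integrable : IntegrableOn (fun z : A.direction => ‖a + v.2 • z‖ ^ 2)
      (chart A c ⁻¹' s.closedInterior) :=
    (by fun_prop : Continuous fun z : A.direction => ‖a + v.2 • z‖ ^ 2).continuousOn
      |>.integrableOn_compact
        ((isometry_chart _).isClosedEmbedding.isCompact_preimage s.isCompact_closedInterior)
  exact setIntegral_mono_set integrable (ae_of_all _ fun z => by positivity)
    (Filter.Eventually.of_forall h.closedBall_subset_chart_preimage)

theorem rtFlux_sq_mul_volume_le (hd : 0 < d) (hdiam : diam s.closedInterior ≤ σ * ρ)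
    (v : A.direction × ℝ) (k : Fin (d + 1)) :
    rtFlux s v k ^ 2 * volume.real (closedBall (0 : A.direction) ρ) ≤
      (2 + 16 * σ ^ 2) * ∫ x in s.closedInterior, ‖rtField s v x‖ ^ 2 ∂μHE[d] := by
  have flux_sq_le : rtFlux s v k ^ 2 ≤
      (2 + 16 * σ ^ 2) * (‖rtField s v c‖ ^ 2 + v.2 ^ 2 * ρ ^ 2 / 8) :=
    calc rtFlux s v k ^ 2 ≤ (‖rtField s v c‖ + |v.2| * (σ * ρ)) ^ 2 := by
          rw [← sq_abs]
          gcongr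
          exact abs_rtFlux_le hd h.center_mem_closedInterior hdiam v k
      _ ≤ 2 * (‖rtField s v c‖ ^ 2 + (|v.2| * (σ * ρ)) ^ 2) := add_sq_le
      _ = 2 * ‖rtField s v c‖ ^ 2 + 16 * σ ^ 2 * (v.2 ^ 2 * ρ ^ 2 / 8) := by
          rw [mul_pow, sq_abs]
          ring
      _ ≤ _ := by
          nlinarith [mul_nonneg (sq_nonneg σ) (sq_nonneg ‖rtField s v c‖),
            mul_nonneg (sq_nonneg v.2) (sq_nonneg ρ)]
  calc _ ≤ (2 + 16 * σ ^ 2) * (‖rtField s v c‖ ^ 2 + v.2 ^ 2 * ρ ^ 2 / 8) *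
        volume.real (closedBall (0 : A.direction) ρ) := by gcongr
    _ = (2 + 16 * σ ^ 2) * (volume.real (closedBall (0 : A.direction) ρ) *
        (‖rtField s v c‖ ^ 2 + v.2 ^ 2 * ρ ^ 2 / 8)) := by ring
    _ ≤ _ := by
        gcongr
        exact h.le_integral_norm_rtField_sq hA hd v

theorem measureReal_closedInterior_le (hdiam : diam s.closedInterior ≤ σ * ρ) :
    (μHE[d]).real s.closedInterior ≤
      σ ^ d * volume.real (closedBall (0 : A.direction) ρ) := by
  have preimage_subset : chart A c ⁻¹' s.closedInterior ⊆ closedBall 0 (σ * ρ) := by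
    intro z hz
    rw [mem_closedBall_zero_iff]
    simpa [chart] using norm_sub_le_of_diam_le hdiam hz h.center_mem_closedInterior
  calc (μHE[d]).real s.closedInterior = volume.real (chart A c ⁻¹' s.closedInterior) := by
        rw [measureReal_def, measureReal_def, measure_eq_volume_chart_preimage hA h.center_mem
          (closedInterior_subset_plane hA)]
    _ ≤ volume.real (closedBall (0 : A.direction) (σ * ρ)) :=
        measureReal_mono preimage_subset measure_closedBall_lt_top.ne
    _ = _ := by
        rw [volume_real_closedBall_mul (h.nonneg_of_diam_le hdiam) h.pos.le, finrank_direction hA]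

theorem norm_basisField_le (hd : 0 < d) (hdiam : diam s.closedInterior ≤ σ * ρ)
    (k : Fin (d + 1)) {x : E n} (hx : x ∈ s.closedInterior) : ‖basisField s k x‖ ≤ σ := by
  have hσ := h.nonneg_of_diam_le hdiam
  have height_pos := height_pos s hd k
  rw [basisField, norm_smul, norm_inv, Real.norm_of_nonneg height_pos.le,
    inv_mul_le_iff₀ height_pos, mul_comm]
  calc ‖x - s.points k‖ ≤ σ * ρ :=
        norm_sub_le_of_diam_le hdiam hx (s.point_mem_closedInterior k)
    _ ≤ σ * height s k := by
        gcongr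
        exact h.le_height hA hd k

theorem integral_norm_basisField_sq_le (hd : 0 < d) (hdiam : diam s.closedInterior ≤ σ * ρ)
    (k : Fin (d + 1)) :
    ∫ x in s.closedInterior, ‖basisField s k x‖ ^ 2 ∂μHE[d] ≤
      σ ^ (d + 2) * volume.real (closedBall (0 : A.direction) ρ) :=
  calc _ ≤ ∫ _ in s.closedInterior, σ ^ 2 ∂μHE[d] := by
        refine setIntegral_mono_on (integrableOn_closedInterior s
          ((continuous_basisField s k).norm.pow 2))
          (integrableOn_const (measure_closedInterior_lt_top s).ne)
          s.isClosed_closedInterior.measurableSet fun x hx => ?_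
        gcongr
        exact h.norm_basisField_le hA hd hdiam k hx
    _ = (μHE[d]).real s.closedInterior * σ ^ 2 := by rw [setIntegral_const, smul_eq_mul]
    _ ≤ σ ^ d * volume.real (closedBall (0 : A.direction) ρ) * σ ^ 2 := by
        gcongr
        exact h.measureReal_closedInterior_le hA hdiam
    _ = _ := by ring

end IsInscribedBall

end Scaling

/-! ### The mass form on a simplex and its lumping -/

section LocalForm

open Metric (closedBall diam)

variable {n d : ℕ} (s : Affine.Simplex ℝ (E n) d) (B : LinearMap.BilinForm ℝ (E n))

theorem integrableOn_bilinForm {f g : E n → E n} (hf : Continuous f) (hg : Continuous g) :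
    IntegrableOn (fun x => B (f x) (g x)) s.closedInterior μHE[d] := by
  have continuous_B : Continuous fun x => B.toContinuousBilinearMap (f x) (g x) := by fun_prop
  exact integrableOn_closedInterior s continuous_B

theorem integrableOn_rtField {D : Submodule ℝ (E n)} (v w : D × ℝ) :
    IntegrableOn (fun x => B (rtField s v x) (rtField s w x)) s.closedInterior μHE[d] :=
  integrableOn_bilinForm s B (continuous_rtField s v) (continuous_rtField s w)

theorem integrableOn_basisField (k : Fin (d + 1)) :
    IntegrableOn (fun x => B (basisField s k x) (basisField s k x)) s.closedInterior μHE[d] :=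
  integrableOn_bilinForm s B (continuous_basisField s k) (continuous_basisField s k)

/-- The form `(v, w) ↦ ∫ B(v, w)` on the `RT₀` fields of a simplex. -/
def massForm (D : Submodule ℝ (E n)) : LinearMap.BilinForm ℝ (D × ℝ) :=
  LinearMap.mk₂ ℝ
    (fun v w => ∫ x in s.closedInterior, B (rtField s v x) (rtField s w x) ∂μHE[d])
    (fun v v' w => by
      rw [← integral_add (integrableOn_rtField s B v w) (integrableOn_rtField s B v' w)]
      simp_rw [rtField_eq_rtEval, map_add, LinearMap.add_apply])
    (fun c v w => by
      rw [smul_eq_mul, ← integral_const_mul]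
      simp_rw [rtField_eq_rtEval, map_smul, LinearMap.smul_apply, smul_eq_mul])
    (fun v w w' => by
      rw [← integral_add (integrableOn_rtField s B v w) (integrableOn_rtField s B v w')]
      simp_rw [rtField_eq_rtEval, map_add])
    (fun c v w => by
      rw [smul_eq_mul, ← integral_const_mul]
      simp_rw [rtField_eq_rtEval, map_smul, smul_eq_mul])

/-- The diagonal entry `∫ B(φ_k, φ_k)` of the mass form at the basis function of the facet `k`. -/
def lumpedWeight (k : Fin (d + 1)) : ℝ :=
  ∫ x in s.closedInterior, B (basisField s k x) (basisField s k x) ∂μHE[d]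

/-- The lumped mass form, which keeps only the diagonal of the mass form with respect to the `RT₀`
basis. -/
def lumpedForm (D : Submodule ℝ (E n)) : LinearMap.BilinForm ℝ (D × ℝ) :=
  LinearMap.mk₂ ℝ (fun v w => ∑ k, rtFlux s v k * rtFlux s w k * lumpedWeight s B k)
    (fun v v' w => by simp only [rtFlux_add, add_mul, Finset.sum_add_distrib])
    (fun c v w => by simp only [rtFlux_smul, mul_assoc, smul_eq_mul, Finset.mul_sum])
    (fun v w w' => by simp only [rtFlux_add, mul_add, add_mul, Finset.sum_add_distrib])
    (fun c v w => by
      simp only [rtFlux_smul, mul_assoc, mul_left_comm _ c, smul_eq_mul, Finset.mul_sum])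

section

variable {D : Submodule ℝ (E n)}

theorem massForm_apply (v w : D × ℝ) : massForm s B D v w =
    ∫ x in s.closedInterior, B (rtField s v x) (rtField s w x) ∂μHE[d] := rfl

theorem lumpedForm_apply (v w : D × ℝ) : lumpedForm s B D v w =
    ∑ k, rtFlux s v k * rtFlux s w k * lumpedWeight s B k := rfl

variable {B}

theorem massForm_isPosSemidef (hB : B.IsPosSemidef) : (massForm s B D).IsPosSemidef where
  eq v w := by simp_rw [massForm_apply, hB.eq (rtField s v _)]
  nonneg _ := integral_nonneg fun _ => hB.nonneg _

theorem lumpedWeight_nonneg (hB : B.IsNonneg) (k : Fin (d + 1)) : 0 ≤ lumpedWeight s B k :=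
  integral_nonneg fun _ => hB.nonneg _

theorem lumpedForm_isPosSemidef (hB : B.IsNonneg) : (lumpedForm s B D).IsPosSemidef where
  eq v w := by simp_rw [lumpedForm_apply, mul_comm (rtFlux s v _)]
  nonneg v := by
    rw [lumpedForm_apply]
    exact Finset.sum_nonneg fun k _ =>
      mul_nonneg (mul_self_nonneg _) (lumpedWeight_nonneg s hB k)

end

variable {s B} {A : AffineSubspace ℝ (E n)} (hA : affineSpan ℝ (Set.range s.points) = A)

include hA

theorem massForm_self_le_lumpedForm_self (hd : 0 < d) (hB : B.IsPosSemidef)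
    (v : A.direction × ℝ) :
    massForm s B A.direction v v ≤ (d + 1) * lumpedForm s B A.direction v v := by
  have pointwise (x : E n) : B (rtField s v x) (rtField s v x) ≤
      (d + 1) * ∑ k, rtFlux s v k * rtFlux s v k * B (basisField s k x) (basisField s k x) := by
    have h := apply_sum_self_le_card_mul_sum hB Finset.univ fun k => rtFlux s v k • basisField s k x
    rw [← rtField_eq_sum hA hd] at h
    simpa [mul_assoc] using h
  have integrable (k : Fin (d + 1)) : IntegrableOn (fun x => rtFlux s v k * rtFlux s v k *
      B (basisField s k x) (basisField s k x)) s.closedInterior μHE[d] :=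
    (integrableOn_basisField s B k).const_mul _
  calc massForm s B A.direction v v ≤ ∫ x in s.closedInterior, (d + 1) *
        ∑ k, rtFlux s v k * rtFlux s v k * B (basisField s k x) (basisField s k x) ∂μHE[d] :=
        integral_mono (integrableOn_rtField s B v v)
          ((integrable_finsetSum _ fun k _ => integrable k).const_mul _) pointwise
    _ = (d + 1) * lumpedForm s B A.direction v v := by
        rw [integral_const_mul, integral_finsetSum _ fun k _ => integrable k]
        simp_rw [integral_const_mul]
        rfl

theorem lumpedWeight_mul_integral_norm_sq_le {κ : ℝ}
    (hB : ∀ x ∈ A.direction, ∀ y ∈ A.direction, B x x * ‖y‖ ^ 2 ≤ κ * (B y y * ‖x‖ ^ 2))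
    (k : Fin (d + 1)) (v : A.direction × ℝ) :
    lumpedWeight s B k * ∫ x in s.closedInterior, ‖rtField s v x‖ ^ 2 ∂μHE[d] ≤
      κ * (massForm s B A.direction v v *
        ∫ x in s.closedInterior, ‖basisField s k x‖ ^ 2 ∂μHE[d]) := by
  have measurableSet := s.isClosed_closedInterior.measurableSet
  refine integral_mul_integral_le_of_ae_le (integrableOn_basisField s B k)
    (integrableOn_closedInterior s ((continuous_basisField s k).norm.pow 2))
    (integrableOn_rtField s B v v)
    (integrableOn_closedInterior s ((continuous_rtField s v).norm.pow 2)) ?_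
  filter_upwards [ae_restrict_mem measurableSet] with y hy
  filter_upwards [ae_restrict_mem measurableSet] with x hx
  exact hB _ (basisField_mem_direction hA k (closedInterior_subset_plane hA hx))
    _ (rtField_mem_direction hA v (closedInterior_subset_plane hA hy))

theorem massForm_self_eq_zero (hd : 0 < d) (hB : ∀ x ≠ 0, 0 < B x x) {v : A.direction × ℝ}
    (hv : massForm s B A.direction v v = 0) : v = 0 := by
  obtain ⟨c, ρ, hball⟩ := exists_isInscribedBall s
  rw [hA] at hball
  have self_nonneg (x : E n) : 0 ≤ B x x := by
    rcases eq_or_ne x 0 with rfl | hx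
    · simp
    · exact (hB x hx).le
  have integral_eq_zero : ∫ x in s.closedInterior, ‖rtField s v x‖ ^ 2 ∂μHE[d] = 0 := by
    refine integral_eq_zero_of_ae ?_
    filter_upwards [(integral_eq_zero_iff_of_nonneg (fun x => self_nonneg _)
      (integrableOn_rtField s B v v)).1 hv] with x hx
    have rtField_eq_zero : rtField s v x = 0 := by_contra fun h => (hB _ h).ne' hx
    simp [rtField_eq_zero]
  refine rtFlux_injective hA hd (funext fun k => ?_)
  have flux_sq_le := hball.rtFlux_sq_mul_volume_le hA hd (div_mul_cancel₀ _ hball.pos.ne').ge v k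
  rw [integral_eq_zero, mul_zero] at flux_sq_le
  refine Eq.trans ?_ (rtFlux_zero s k).symm
  exact pow_eq_zero_iff two_ne_zero |>.1
    ((nonpos_of_mul_nonpos_left flux_sq_le hball.volume_real_closedBall_pos).antisymm (sq_nonneg _))

variable {c : E n} {ρ σ κ : ℝ}

theorem rtFlux_sq_mul_lumpedWeight_le (hd : 0 < d) (hB_psd : B.IsPosSemidef) (hκ : 0 ≤ κ)
    (hB : ∀ x ∈ A.direction, ∀ y ∈ A.direction, B x x * ‖y‖ ^ 2 ≤ κ * (B y y * ‖x‖ ^ 2))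
    (hball : IsInscribedBall s A c ρ) (hdiam : diam s.closedInterior ≤ σ * ρ)
    (v : A.direction × ℝ) (k : Fin (d + 1)) :
    rtFlux s v k ^ 2 * lumpedWeight s B k ≤
      κ * σ ^ (d + 2) * (2 + 16 * σ ^ 2) * massForm s B A.direction v v := by
  have flux_sq_le := hball.rtFlux_sq_mul_volume_le hA hd hdiam v k
  have basis_le := hball.integral_norm_basisField_sq_le hA hd hdiam k
  have weight_le := lumpedWeight_mul_integral_norm_sq_le hA hB k v
  have weight_nonneg := lumpedWeight_nonneg s hB_psd.isNonneg k
  have mass_nonneg := (massForm_isPosSemidef s hB_psd (D := A.direction)).nonneg v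
  set V := volume.real (closedBall (0 : A.direction) ρ)
  set I := ∫ x in s.closedInterior, ‖rtField s v x‖ ^ 2 ∂μHE[d]
  refine le_of_mul_le_mul_right ?_ (hball.volume_real_closedBall_pos : 0 < V)
  calc rtFlux s v k ^ 2 * lumpedWeight s B k * V
      = lumpedWeight s B k * (rtFlux s v k ^ 2 * V) := by ring
    _ ≤ lumpedWeight s B k * ((2 + 16 * σ ^ 2) * I) := by gcongr
    _ = (2 + 16 * σ ^ 2) * (lumpedWeight s B k * I) := by ring
    _ ≤ (2 + 16 * σ ^ 2) * (κ * (massForm s B A.direction v v *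
        ∫ x in s.closedInterior, ‖basisField s k x‖ ^ 2 ∂μHE[d])) := by gcongr
    _ ≤ (2 + 16 * σ ^ 2) * (κ * (massForm s B A.direction v v * (σ ^ (d + 2) * V))) := by gcongr
    _ = _ := by ring

theorem lumpedForm_self_le_massForm_self (hd : 0 < d) (hB_psd : B.IsPosSemidef) (hκ : 0 ≤ κ)
    (hB : ∀ x ∈ A.direction, ∀ y ∈ A.direction, B x x * ‖y‖ ^ 2 ≤ κ * (B y y * ‖x‖ ^ 2))
    (hball : IsInscribedBall s A c ρ) (hdiam : diam s.closedInterior ≤ σ * ρ)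
    (v : A.direction × ℝ) :
    lumpedForm s B A.direction v v ≤ (d + 1) *
      (κ * σ ^ (d + 2) * (2 + 16 * σ ^ 2) * massForm s B A.direction v v) := by
  simp_rw [lumpedForm_apply, ← sq]
  simpa using Finset.sum_le_card_nsmul Finset.univ _ _ fun k _ =>
    rtFlux_sq_mul_lumpedWeight_le hA hd hB_psd hκ hB hball hdiam v k

end LocalForm

/-! ### The forms `a` and `a^D` -/

namespace MeshData

variable {n : ℕ} {M : MeshData n}

namespace Params

section Permeability

variable (P : M.Params) (i : M.Sub)

/-- The bilinear form `(x, y) ↦ ⟪K⁻¹ x, y⟫` of the inverse permeability on the subdomain `i`. -/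
def invKForm : LinearMap.BilinForm ℝ (E n) := innerₗ (E n) ∘ₗ (P.K i).symm.toLinearMap

theorem invKForm_apply (x y : E n) : P.invKForm i x y = inner ℝ ((P.K i).symm x) y := rfl

theorem invKForm_self_pos {x : E n} (hx : x ≠ 0) : 0 < P.invKForm i x x := by
  have h := P.K_pos i ((P.K i).symm x) (by simpa using hx)
  rwa [(P.K i).apply_symm_apply, real_inner_comm] at h

theorem invKForm_isPosSemidef : (P.invKForm i).IsPosSemidef where
  eq x y := by
    have h := P.K_symm i ((P.K i).symm x) ((P.K i).symm y)
    rw [(P.K i).apply_symm_apply, (P.K i).apply_symm_apply] at h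
    rw [invKForm_apply, invKForm_apply, ← h, real_inner_comm]
  nonneg x := by
    rcases eq_or_ne x 0 with rfl | hx
    · simp
    · exact (P.invKForm_self_pos i hx).le

theorem K_symm_apply_mem_direction {x : E n} (hx : x ∈ (M.plane i).direction) :
    (P.K i).symm x ∈ (M.plane i).direction := by
  have hmap : (M.plane i).direction.map (P.K i).toLinearMap = (M.plane i).direction := by
    refine Submodule.eq_of_le_of_finrank_eq ?_ (LinearEquiv.finrank_map_eq (P.K i) _)
    rintro _ ⟨y, hy, rfl⟩
    exact P.K_tangential i y hy
  rw [← hmap] at hx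
  obtain ⟨y, hy, rfl⟩ := hx
  simpa using hy

variable {P} {κ : ℝ}

theorem AnisotropyLE.inner_K_self_mul_norm_sq_le (hκ : P.AnisotropyLE κ) {x y : E n}
    (hx : x ∈ (M.plane i).direction) (hy : y ∈ (M.plane i).direction) :
    inner ℝ (P.K i x) x * ‖y‖ ^ 2 ≤ κ * (inner ℝ (P.K i y) y * ‖x‖ ^ 2) := by
  rcases eq_or_ne x 0 with rfl | hx0
  · simp
  rcases eq_or_ne y 0 with rfl | hy0
  · simp
  have inner_unit (z : E n) (hz : z ≠ 0) :
      inner ℝ (P.K i (‖z‖⁻¹ • z)) (‖z‖⁻¹ • z) = inner ℝ (P.K i z) z / ‖z‖ ^ 2 := by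
    have : ‖z‖ ≠ 0 := norm_ne_zero_iff.2 hz
    rw [map_smul, real_inner_smul_left, real_inner_smul_right]
    field_simp
  have h := hκ i _ (Submodule.smul_mem _ ‖x‖⁻¹ hx) _ (Submodule.smul_mem _ ‖y‖⁻¹ hy)
    (norm_smul_inv_norm hx0) (norm_smul_inv_norm hy0)
  rw [inner_unit x hx0, inner_unit y hy0, mul_div_assoc', div_le_div_iff₀ (by positivity)
    (by positivity)] at h
  linarith

theorem AnisotropyLE.invKForm_self_mul_norm_sq_le (hκ : P.AnisotropyLE κ) {x y : E n}
    (hx : x ∈ (M.plane i).direction) (hy : y ∈ (M.plane i).direction) :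
    P.invKForm i x x * ‖y‖ ^ 2 ≤ κ * (P.invKForm i y y * ‖x‖ ^ 2) :=
  inner_symm_self_mul_norm_sq_le (P.K_symm i) (P.K_pos i)
    (fun _ hz => P.K_symm_apply_mem_direction i hz)
    (fun _ hz _ hz' => hκ.inner_K_self_mul_norm_sq_le i hz hz') hx hy

theorem AnisotropyLE.mono {κ' : ℝ} (hκ : P.AnisotropyLE κ) (h : κ ≤ κ') : P.AnisotropyLE κ' :=
  fun i x hx y hy hx1 hy1 => (hκ i x hx y hy hx1 hy1).trans <| mul_le_mul_of_nonneg_right h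
    (P.K_pos i y (norm_ne_zero_iff.1 (hy1 ▸ one_ne_zero))).le

end Permeability

section Mortar

variable (P : M.Params)

/-- The integral of `γ Kν⁻¹` over a mortar element. -/
def mortarWeight (g : M.Iface) (m : M.MCell g) : ℝ :=
  ∫ x in (M.mcell g m).closedInterior, P.γ g * (P.Kν g x)⁻¹ ∂μHE[M.dim (M.lower g)]

theorem mortarForm_eq_sum (lam μ : M.Lh) :
    P.mortarForm lam μ = ∑ g, ∑ m, P.mortarWeight g m * (lam g m * μ g m) := by
  simp only [mortarForm, mortarWeight, ← integral_mul_const, mul_assoc]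

/-- `P.mortarForm` as a bilinear form. -/
def mortarBilinForm : LinearMap.BilinForm ℝ M.Lh :=
  LinearMap.mk₂ ℝ P.mortarForm
    (fun lam lam' μ => by
      simp only [mortarForm_eq_sum, Pi.add_apply, add_mul, mul_add, Finset.sum_add_distrib])
    (fun c lam μ => by
      simp only [mortarForm_eq_sum, Pi.smul_apply, smul_eq_mul, Finset.mul_sum, mul_assoc,
        mul_left_comm c])
    (fun lam μ μ' => by
      simp only [mortarForm_eq_sum, Pi.add_apply, mul_add, Finset.sum_add_distrib])
    (fun c lam μ => by
      simp only [mortarForm_eq_sum, Pi.smul_apply, smul_eq_mul, Finset.mul_sum, mul_left_comm _ c])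

theorem mortarBilinForm_apply (lam μ : M.Lh) : P.mortarBilinForm lam μ = P.mortarForm lam μ := rfl

variable (hM : M.IsMesh)

include hM

theorem exists_bounds_mortarDensity (g : M.Iface) (m : M.MCell g) :
    ∃ c C : ℝ, 0 < c ∧ ∀ x ∈ (M.mcell g m).closedInterior,
      c ≤ P.γ g * (P.Kν g x)⁻¹ ∧ P.γ g * (P.Kν g x)⁻¹ ≤ C := by
  obtain ⟨c, C, hc, hcC⟩ := P.Kν_bounds g
  have hsub : (M.mcell g m).closedInterior ⊆ M.region (M.lower g) := by
    rw [← hM.mortar_cover g]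
    exact Set.subset_iUnion (fun m => (M.mcell g m).closedInterior) m
  have hγ := P.γ_pos g
  obtain ⟨x₀, hx₀⟩ := (M.mcell g m).nonempty_closedInterior
  have hC : 0 < C := hc.trans_le ((hcC x₀ (hsub hx₀)).1.trans (hcC x₀ (hsub hx₀)).2)
  refine ⟨P.γ g * C⁻¹, P.γ g * c⁻¹, by positivity, fun x hx => ?_⟩
  obtain ⟨hlower, hupper⟩ := hcC x (hsub hx)
  have hpos : 0 < P.Kν g x := hc.trans_le hlower
  exact ⟨by gcongr, by gcongr⟩

theorem mortarWeight_pos (g : M.Iface) (m : M.MCell g) : 0 < P.mortarWeight g m := by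
  obtain ⟨c, C, hc, hcC⟩ := P.exists_bounds_mortarDensity hM g m
  have hmeas := (M.mcell g m).isClosed_closedInterior.measurableSet
  have hfin := (measure_closedInterior_lt_top (M.mcell g m)).ne
  have integrable : IntegrableOn (fun x => P.γ g * (P.Kν g x)⁻¹) (M.mcell g m).closedInterior
      μHE[M.dim (M.lower g)] := by
    refine Measure.integrableOn_of_bounded (M := C) hfin
      ((P.Kν_measurable g).inv.const_mul _).aestronglyMeasurable
      (ae_restrict_of_forall_mem hmeas fun x hx => ?_)
    rw [Real.norm_of_nonneg (hc.le.trans (hcC x hx).1)]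
    exact (hcC x hx).2
  calc 0 < (μHE[M.dim (M.lower g)]).real (M.mcell g m).closedInterior * c :=
        mul_pos (measureReal_closedInterior_pos _) hc
    _ = ∫ _ in (M.mcell g m).closedInterior, c ∂μHE[M.dim (M.lower g)] := by
        rw [setIntegral_const, smul_eq_mul]
    _ ≤ P.mortarWeight g m := setIntegral_mono_on (integrableOn_const hfin) integrable hmeas
        fun x hx => (hcC x hx).1

theorem mortarBilinForm_isPosSemidef : P.mortarBilinForm.IsPosSemidef where
  eq lam μ := by
    simp only [mortarBilinForm_apply, mortarForm_eq_sum, mul_comm (lam _ _)]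
  nonneg lam := by
    rw [mortarBilinForm_apply, mortarForm_eq_sum]
    exact Finset.sum_nonneg fun g _ => Finset.sum_nonneg fun m _ =>
      mul_nonneg (P.mortarWeight_pos hM g m).le (mul_self_nonneg _)

theorem eq_zero_of_mortarForm_self_eq_zero {lam : M.Lh} (h : P.mortarForm lam lam = 0) :
    lam = 0 := by
  have hpos := P.mortarWeight_pos hM
  have hnonneg (g : M.Iface) (m : M.MCell g) : 0 ≤ P.mortarWeight g m * (lam g m * lam g m) :=
    mul_nonneg (hpos g m).le (mul_self_nonneg _)
  rw [mortarForm_eq_sum, Fintype.sum_eq_zero_iff_of_nonneg fun g =>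
    Finset.sum_nonneg fun m _ => hnonneg g m] at h
  funext g m
  have hg := (Fintype.sum_eq_zero_iff_of_nonneg (hnonneg g)).1 (congrFun h g)
  simpa [(hpos g m).ne'] using congrFun hg m

end Mortar

section GlobalForms

variable (P : M.Params) (R : M.Lh →ₗ[ℝ] M.Vh)

/-- The restriction of the total flux `v₀ + R_h μ` to the element `T`, as a linear map. -/
def totalOn (i : M.Sub) (T : M.Cell i) : M.Wh →ₗ[ℝ] (M.plane i).direction × ℝ :=
  LinearMap.proj T ∘ₗ LinearMap.proj i ∘ₗ M.V0h.subtype.coprod (M.Vh.subtype ∘ₗ R)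

theorem totalOn_apply (i : M.Sub) (T : M.Cell i) (r : M.Wh) : totalOn R i T r = total R r i T :=
  rfl

theorem totalOn_eq_zero_of_dim_eq_zero {i : M.Sub} (hi : M.dim i = 0) (T : M.Cell i) (r : M.Wh) :
    totalOn R i T r = 0 := by
  rw [totalOn_apply, total, Pi.add_apply, r.1.2.1.1 i hi, (R r.2).2.1 i hi, add_zero,
    Pi.zero_apply]

/-- The contribution of the element `T` to `a`. -/
abbrev cellMassForm (i : M.Sub) (T : M.Cell i) :
    LinearMap.BilinForm ℝ ((M.plane i).direction × ℝ) :=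
  massForm (M.cell i T) (P.invKForm i) (M.plane i).direction

/-- The contribution of the element `T` to `a^D`. -/
abbrev cellLumpedForm (i : M.Sub) (T : M.Cell i) :
    LinearMap.BilinForm ℝ ((M.plane i).direction × ℝ) :=
  lumpedForm (M.cell i T) (P.invKForm i) (M.plane i).direction

/-- `P.a R` as a bilinear form. -/
def aForm : LinearMap.BilinForm ℝ M.Wh :=
  (∑ i, ∑ T, (P.cellMassForm i T).comp (totalOn R i T) (totalOn R i T)) +
    P.mortarBilinForm.comp (LinearMap.snd ℝ _ _) (LinearMap.snd ℝ _ _)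

/-- `P.aD R` as a bilinear form. -/
def aDForm : LinearMap.BilinForm ℝ M.Wh :=
  (∑ i, ∑ T, (P.cellLumpedForm i T).comp (totalOn R i T) (totalOn R i T)) +
    P.mortarBilinForm.comp (LinearMap.snd ℝ _ _) (LinearMap.snd ℝ _ _)

theorem aForm_eq_sum (w r : M.Wh) : P.aForm R w r =
    (∑ i, ∑ T, P.cellMassForm i T (totalOn R i T w) (totalOn R i T r)) +
      P.mortarBilinForm w.2 r.2 := by
  simp only [aForm, LinearMap.add_apply, LinearMap.sum_apply, LinearMap.BilinForm.comp_apply,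
    LinearMap.snd_apply]

theorem aDForm_eq_sum (w r : M.Wh) : P.aDForm R w r =
    (∑ i, ∑ T, P.cellLumpedForm i T (totalOn R i T w) (totalOn R i T r)) +
      P.mortarBilinForm w.2 r.2 := by
  simp only [aDForm, LinearMap.add_apply, LinearMap.sum_apply, LinearMap.BilinForm.comp_apply,
    LinearMap.snd_apply]

theorem aForm_apply (w r : M.Wh) : P.aForm R w r = P.a R w r := P.aForm_eq_sum R w r

theorem aDForm_apply (w r : M.Wh) : P.aDForm R w r = P.aD R w r := P.aDForm_eq_sum R w r

theorem cellMassForm_isPosSemidef (i : M.Sub) (T : M.Cell i) :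
    (P.cellMassForm i T).IsPosSemidef :=
  massForm_isPosSemidef _ (P.invKForm_isPosSemidef i)

theorem cellLumpedForm_isPosSemidef (i : M.Sub) (T : M.Cell i) :
    (P.cellLumpedForm i T).IsPosSemidef :=
  lumpedForm_isPosSemidef _ (P.invKForm_isPosSemidef i).isNonneg

/-- The constant in `a^D ≤ C a`: the factors `n + 1`, `κ` and the power of `σ` come from the number
of facets, the anisotropy and the comparison of an element with its inscribed ball. -/
def lumpingBound (n : ℕ) (σ κ : ℝ) : ℝ :=
  (n + 1) * (|κ| * max 1 σ ^ (n + 2) * (2 + 16 * σ ^ 2)) + 1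

theorem one_le_lumpingBound (n : ℕ) (σ κ : ℝ) : 1 ≤ lumpingBound n σ κ := by
  rw [lumpingBound, le_add_iff_nonneg_left]
  positivity

variable (hM : M.IsMesh)

include hM

theorem aForm_isPosSemidef : (P.aForm R).IsPosSemidef where
  eq w r := by
    simp only [aForm_eq_sum, (P.cellMassForm_isPosSemidef _ _).eq (totalOn R _ _ w),
      (P.mortarBilinForm_isPosSemidef hM).eq w.2]
  nonneg r := by
    rw [aForm_eq_sum]
    exact add_nonneg (Finset.sum_nonneg fun i _ => Finset.sum_nonneg fun T _ =>
      (P.cellMassForm_isPosSemidef i T).nonneg _) ((P.mortarBilinForm_isPosSemidef hM).nonneg _)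

theorem aDForm_isPosSemidef : (P.aDForm R).IsPosSemidef where
  eq w r := by
    simp only [aDForm_eq_sum, (P.cellLumpedForm_isPosSemidef _ _).eq (totalOn R _ _ w),
      (P.mortarBilinForm_isPosSemidef hM).eq w.2]
  nonneg r := by
    rw [aDForm_eq_sum]
    exact add_nonneg (Finset.sum_nonneg fun i _ => Finset.sum_nonneg fun T _ =>
      (P.cellLumpedForm_isPosSemidef i T).nonneg _) ((P.mortarBilinForm_isPosSemidef hM).nonneg _)

theorem cellMassForm_self_le (i : M.Sub) (T : M.Cell i) (r : M.Wh) :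
    P.cellMassForm i T (totalOn R i T r) (totalOn R i T r) ≤
      (n + 1) * P.cellLumpedForm i T (totalOn R i T r) (totalOn R i T r) := by
  rcases Nat.eq_zero_or_pos (M.dim i) with hd | hd
  · simp [totalOn_eq_zero_of_dim_eq_zero R hd T r]
  have hA := hM.affineSpan_cell i T
  have hdim : (M.dim i : ℝ) ≤ n := by exact_mod_cast dim_le hA
  refine (massForm_self_le_lumpedForm_self hA hd (P.invKForm_isPosSemidef i) _).trans ?_
  exact mul_le_mul_of_nonneg_right (by gcongr) ((P.cellLumpedForm_isPosSemidef i T).nonneg _)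

theorem aForm_self_le (r : M.Wh) : P.aForm R r r ≤ (n + 1) * P.aDForm R r r := by
  rw [aForm_eq_sum, aDForm_eq_sum, mul_add, Finset.mul_sum]
  simp_rw [Finset.mul_sum Finset.univ (fun T => P.cellLumpedForm _ T _ _)]
  refine add_le_add (Finset.sum_le_sum fun i _ => Finset.sum_le_sum fun T _ =>
    P.cellMassForm_self_le R hM i T r) ?_
  exact le_mul_of_one_le_left ((P.mortarBilinForm_isPosSemidef hM).nonneg _) (by simp)

variable {P} {σ κ : ℝ} (hσ : M.ShapeRegular σ) (hκ : P.AnisotropyLE κ)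

include hσ hκ

theorem cellLumpedForm_self_le (i : M.Sub) (T : M.Cell i) (r : M.Wh) :
    P.cellLumpedForm i T (totalOn R i T r) (totalOn R i T r) ≤
      lumpingBound n σ κ * P.cellMassForm i T (totalOn R i T r) (totalOn R i T r) := by
  rcases Nat.eq_zero_or_pos (M.dim i) with hd | hd
  · simp [totalOn_eq_zero_of_dim_eq_zero R hd T r]
  have hA := hM.affineSpan_cell i T
  obtain ⟨c, hc, ρ, hρ, hsub, hdiam⟩ := hσ i T hd
  have hball : IsInscribedBall (M.cell i T) (M.plane i) c ρ := ⟨hρ, hc, hsub⟩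
  have hdim : M.dim i ≤ n := dim_le hA
  have hσ_nonneg : 0 ≤ σ := hball.nonneg_of_diam_le hdiam
  have hpow : σ ^ (M.dim i + 2) ≤ max 1 σ ^ (n + 2) :=
    (pow_le_pow_left₀ hσ_nonneg (le_max_right _ _) _).trans
      (pow_le_pow_right₀ (le_max_left _ _) (by gcongr))
  refine (lumpedForm_self_le_massForm_self hA hd (P.invKForm_isPosSemidef i) (abs_nonneg κ)
    (fun _ hx _ hy => (hκ.mono (le_abs_self κ)).invKForm_self_mul_norm_sq_le i hx hy) hball hdiam
    _).trans ?_
  rw [← mul_assoc]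
  refine mul_le_mul_of_nonneg_right ?_ ((P.cellMassForm_isPosSemidef i T).nonneg _)
  calc (M.dim i + 1 : ℝ) * (|κ| * σ ^ (M.dim i + 2) * (2 + 16 * σ ^ 2))
      ≤ (n + 1) * (|κ| * max 1 σ ^ (n + 2) * (2 + 16 * σ ^ 2)) := by gcongr
    _ ≤ lumpingBound n σ κ := by rw [lumpingBound]; linarith

theorem aDForm_self_le (r : M.Wh) : P.aDForm R r r ≤ lumpingBound n σ κ * P.aForm R r r := by
  rw [aForm_eq_sum, aDForm_eq_sum, mul_add, Finset.mul_sum]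
  simp_rw [Finset.mul_sum Finset.univ (fun T => P.cellMassForm _ T _ _)]
  refine add_le_add (Finset.sum_le_sum fun i _ => Finset.sum_le_sum fun T _ =>
    cellLumpedForm_self_le R hM hσ hκ i T r) ?_
  exact le_mul_of_one_le_left ((P.mortarBilinForm_isPosSemidef hM).nonneg _)
    (one_le_lumpingBound n σ κ)

omit hσ hκ

theorem totalOn_eq_zero_of_sum_cellMassForm_eq_zero {r : M.Wh}
    (h : ∑ i, ∑ T, P.cellMassForm i T (totalOn R i T r) (totalOn R i T r) = 0) (i : M.Sub)
    (T : M.Cell i) : totalOn R i T r = 0 := by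
  have hnonneg (i : M.Sub) (T : M.Cell i) :=
    (P.cellMassForm_isPosSemidef i T).nonneg (totalOn R i T r)
  rw [Fintype.sum_eq_zero_iff_of_nonneg fun i => Finset.sum_nonneg fun T _ => hnonneg i T] at h
  have hcell := congrFun ((Fintype.sum_eq_zero_iff_of_nonneg (hnonneg i)).1 (congrFun h i)) T
  rcases Nat.eq_zero_or_pos (M.dim i) with hd | hd
  · exact totalOn_eq_zero_of_dim_eq_zero R hd T r
  · exact massForm_self_eq_zero (hM.affineSpan_cell i T) hd (fun _ => P.invKForm_self_pos i) hcell

theorem eq_zero_of_aForm_self_eq_zero {r : M.Wh} (h : P.aForm R r r = 0) : r = 0 := by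
  rw [aForm_eq_sum, add_eq_zero_iff_of_nonneg (Finset.sum_nonneg fun i _ => Finset.sum_nonneg
    fun T _ => (P.cellMassForm_isPosSemidef i T).nonneg _)
      ((P.mortarBilinForm_isPosSemidef hM).nonneg _)] at h
  have hmortar : r.2 = 0 := P.eq_zero_of_mortarForm_self_eq_zero hM h.2
  have htotal : total R r = 0 := by
    funext i T
    exact totalOn_eq_zero_of_sum_cellMassForm_eq_zero R hM h.1 i T
  rw [total, hmortar, map_zero, Submodule.coe_zero, add_zero] at htotal
  exact Prod.ext (Subtype.ext htotal) hmortar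

theorem eq_zero_of_aDForm_self_eq_zero {r : M.Wh} (h : P.aDForm R r r = 0) : r = 0 := by
  refine eq_zero_of_aForm_self_eq_zero (P := P) R hM (le_antisymm ?_
    ((P.aForm_isPosSemidef R hM).nonneg r))
  simpa [h] using P.aForm_self_le R hM r

end GlobalForms

end Params

end MeshData

/-! ### Fields with prescribed normal components -/

namespace MeshData

variable {n : ℕ} {M : MeshData n}

/-- The facets of all the elements, each seen from its element: an interior facet, and a facet on
either side of a fracture, occurs twice. -/
abbrev Facet (M : MeshData n) := Σ i : M.Sub, M.Cell i × Fin (M.dim i + 1)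

/-- The relation `InteriorPair` on the facets of all the subdomains. -/
inductive FacetPair : M.Facet → M.Facet → Prop
  | intro {i : M.Sub} {T T' : M.Cell i} {k k' : Fin (M.dim i + 1)}
      (h : M.InteriorPair i T k T' k') : FacetPair ⟨i, T, k⟩ ⟨i, T', k'⟩

theorem onGamma_congr {i : M.Sub} {T T' : M.Cell i} {k k' : Fin (M.dim i + 1)}
    (h : (M.cell i T).points '' {k}ᶜ = (M.cell i T').points '' {k'}ᶜ) :
    M.OnGamma i T k ↔ M.OnGamma i T' k' := by
  simp only [OnGamma, facet, h]

theorem OnGamma.dim_pos {i : M.Sub} {T : M.Cell i} {k : Fin (M.dim i + 1)}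
    (h : M.OnGamma i T k) : 0 < M.dim i := by
  obtain ⟨j, hj, -⟩ := h
  lia

theorem InteriorPair.symm {i : M.Sub} {T T' : M.Cell i} {k k' : Fin (M.dim i + 1)}
    (h : M.InteriorPair i T k T' k') : M.InteriorPair i T' k' T k :=
  ⟨h.1, h.2.1.symm, h.2.2.1.symm, fun h' => h.2.2.2 ((onGamma_congr h.2.2.1).2 h')⟩

namespace FacetPair

variable {f f' f'' : M.Facet}

theorem symm (h : FacetPair f f') : FacetPair f' f := by
  obtain ⟨h⟩ := h
  exact ⟨h.symm⟩

theorem not_onGamma (h : FacetPair f f') : ¬ M.OnGamma f.1 f.2.1 f.2.2 := by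
  obtain ⟨h⟩ := h
  exact h.2.2.2

theorem not_outer (h : FacetPair f f') : ¬ M.Outer f.1 f.2.1 f.2.2 := by
  obtain ⟨h⟩ := h
  exact fun hout => hout.2.2 _ _ h

theorem unique (hM : M.IsMesh) (h : FacetPair f f') (h' : FacetPair f f'') : f' = f'' := by
  obtain @⟨i, T, T₁, k, k₁, h⟩ := h
  obtain @⟨_, _, T₂, _, k₂, h'⟩ := h'
  obtain rfl := hM.neighbour_unique i T T₁ T₂ k k₁ k₂ h h'
  have hcompl := (M.cell i T₁).independent.injective.image_injective
    (h.2.2.1.symm.trans h'.2.2.1)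
  rw [compl_inj_iff, Set.singleton_eq_singleton_iff] at hcompl
  rw [hcompl]

end FacetPair

/-- The functions on the facets that are the normal components of a field of `V_h`. -/
structure IsNormalFlux (c : M.Facet → ℝ) : Prop where
  pair : ∀ f f', FacetPair f f' → c f + c f' = 0
  outer : ∀ f : M.Facet, M.Outer f.1 f.2.1 f.2.2 → ¬ M.DirichletFacet f.1 f.2.1 f.2.2 → c f = 0

namespace IsNormalFlux

theorem of_forall_not_onGamma {c : M.Facet → ℝ}
    (hc : ∀ f : M.Facet, ¬ M.OnGamma f.1 f.2.1 f.2.2 → c f = 0) : IsNormalFlux c where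
  pair f f' h := by rw [hc f h.not_onGamma, hc f' h.symm.not_onGamma, add_zero]
  outer f h _ := hc f h.2.1

variable [DecidableEq M.Facet] {f f' : M.Facet}

theorem single_of_dirichletFacet (h : M.DirichletFacet f.1 f.2.1 f.2.2) :
    IsNormalFlux (Pi.single f 1) where
  pair e e' hpair := by
    rw [Pi.single_eq_of_ne (by rintro rfl; exact hpair.not_outer h.1),
      Pi.single_eq_of_ne (by rintro rfl; exact hpair.symm.not_outer h.1), add_zero]
  outer e _ hD := Pi.single_eq_of_ne (by rintro rfl; exact hD h) _

theorem single_sub_single (hM : M.IsMesh) (h : FacetPair f f') :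
    IsNormalFlux (Pi.single f 1 - Pi.single f' 1) where
  pair e e' hpair := by
    have he : e = f ↔ e' = f' :=
      ⟨by rintro rfl; exact hpair.unique hM h, by rintro rfl; exact hpair.symm.unique hM h.symm⟩
    have he' : e = f' ↔ e' = f :=
      ⟨by rintro rfl; exact hpair.unique hM h.symm, by rintro rfl; exact hpair.symm.unique hM h⟩
    simp only [Pi.sub_apply, Pi.single_apply, he, he']
    ring
  outer e hout _ := by
    rw [Pi.sub_apply, Pi.single_eq_of_ne (by rintro rfl; exact h.not_outer hout),
      Pi.single_eq_of_ne (by rintro rfl; exact h.symm.not_outer hout), sub_zero]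

end IsNormalFlux

open Classical in
/-- The elementwise `RT₀` field with the normal components `c`. -/
def fieldOfFlux (hM : M.IsMesh) (c : M.Facet → ℝ) : M.Field := fun i T =>
  if M.dim i = 0 then 0 else ofFlux (hM.affineSpan_cell i T) fun k => c ⟨i, T, k⟩

theorem flux_fieldOfFlux (hM : M.IsMesh) (c : M.Facet → ℝ) {i : M.Sub} (hi : 0 < M.dim i)
    (T : M.Cell i) (k : Fin (M.dim i + 1)) : M.flux (fieldOfFlux hM c) i T k = c ⟨i, T, k⟩ := by
  rw [flux, fieldOfFlux, if_neg hi.ne', rtFlux_ofFlux _ hi]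

theorem fieldOfFlux_mem_Vh (hM : M.IsMesh) {c : M.Facet → ℝ} (hc : IsNormalFlux c) :
    fieldOfFlux hM c ∈ M.Vh := by
  refine ⟨fun i hi => funext fun T => if_pos hi, fun i T k T' k' h => ?_, fun i T k h h' => ?_⟩
  · rw [flux_fieldOfFlux hM c h.1, flux_fieldOfFlux hM c h.1]
    exact hc.pair _ _ ⟨h⟩
  · rw [flux_fieldOfFlux hM c h.1]
    exact hc.outer _ h h'

theorem flux_sub (v w : M.Field) (i : M.Sub) (T : M.Cell i) (k : Fin (M.dim i + 1)) :
    M.flux (v - w) i T k = M.flux v i T k - M.flux w i T k := by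
  simp only [flux, rtFlux_eq_rtFluxMap, Pi.sub_apply, map_sub]

/-! ### The divergence in terms of the facet fluxes -/

/-- The weight `d |T| / h` of the facet `f` of `T`, where `h` is the height of `T` over `f`: the
contribution of a unit normal component on `f` to the integral of the divergence over `T`. -/
def facetWeight (f : M.Facet) : ℝ :=
  M.dim f.1 / height (M.cell f.1 f.2.1) f.2.2 *
    (μHE[M.dim f.1]).real (M.cell f.1 f.2.1).closedInterior

theorem facetWeight_pos {f : M.Facet} (hf : 0 < M.dim f.1) : 0 < facetWeight f :=
  mul_pos (div_pos (Nat.cast_pos.2 hf) (height_pos _ hf _)) (measureReal_closedInterior_pos _)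

theorem facetWeight_of_dim_eq_zero {f : M.Facet} (hf : M.dim f.1 = 0) : facetWeight f = 0 := by
  simp [facetWeight, hf]

theorem rtDiv_mul_measureReal (hM : M.IsMesh) (v : M.Field) (i : M.Sub) (T : M.Cell i) :
    rtDiv (M.dim i) (v i T) * (μHE[M.dim i]).real (M.cell i T).closedInterior =
      ∑ k, M.flux v i T k * facetWeight (⟨i, T, k⟩ : M.Facet) := by
  rcases Nat.eq_zero_or_pos (M.dim i) with hd | hd
  · simp [rtDiv, facetWeight_of_dim_eq_zero, hd]
  · rw [rtDiv_eq_sum (hM.affineSpan_cell i T) hd, Finset.sum_mul]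
    exact Finset.sum_congr rfl fun k _ => by rw [facetWeight, flux, mul_assoc]

theorem b_eq_sum_facetWeight (hM : M.IsMesh) (R : M.Lh →ₗ[ℝ] M.Vh) (r : M.Wh) (q : M.Qh) :
    b R r q = -((∑ f : M.Facet, M.flux (Params.total R r) f.1 f.2.1 f.2.2 *
      (q f.1 f.2.1 * facetWeight f)) + jumpPairing q r.2) := by
  rw [b, Fintype.sum_sigma]
  congr! with i
  rw [Fintype.sum_prod_type]
  congr! with T
  rw [mul_assoc, rtDiv_mul_measureReal hM, Finset.mul_sum]
  exact Finset.sum_congr rfl fun k _ => mul_left_comm _ _ _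

theorem sum_mul_facetWeight_eq (hM : M.IsMesh) {R : M.Lh →ₗ[ℝ] M.Vh} {q : M.Qh}
    (hq : ∀ r, b R r q = 0) {c : M.Facet → ℝ} (hc : IsNormalFlux c) (μ : M.Lh)
    (hΓ : ∀ f : M.Facet, M.OnGamma f.1 f.2.1 f.2.2 → c f = M.flux (R μ) f.1 f.2.1 f.2.2) :
    ∑ f : M.Facet, c f * (q f.1 f.2.1 * facetWeight f) = -jumpPairing q μ := by
  have hmem : fieldOfFlux hM c - (R μ : M.Field) ∈ M.V0h := by
    refine ⟨M.Vh.sub_mem (fieldOfFlux_mem_Vh hM hc) (R μ).2, fun i T k h => ?_⟩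
    rw [flux_sub, flux_fieldOfFlux hM c h.dim_pos, hΓ ⟨i, T, k⟩ h, sub_self]
  have hb := hq (⟨_, hmem⟩, μ)
  rw [b_eq_sum_facetWeight hM, neg_eq_zero, Params.total, sub_add_cancel,
    add_eq_zero_iff_eq_neg] at hb
  rw [← hb]
  refine Finset.sum_congr rfl fun f _ => ?_
  rcases Nat.eq_zero_or_pos (M.dim f.1) with hd | hd
  · simp only [facetWeight_of_dim_eq_zero hd, mul_zero]
  · rw [flux_fieldOfFlux hM c hd]

theorem sum_mul_facetWeight_eq_zero (hM : M.IsMesh) {R : M.Lh →ₗ[ℝ] M.Vh} {q : M.Qh}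
    (hq : ∀ r, b R r q = 0) {c : M.Facet → ℝ} (hc : IsNormalFlux c)
    (hΓ : ∀ f : M.Facet, M.OnGamma f.1 f.2.1 f.2.2 → c f = 0) :
    ∑ f : M.Facet, c f * (q f.1 f.2.1 * facetWeight f) = 0 := by
  rw [sum_mul_facetWeight_eq hM hq hc 0 fun f hf => by
    rw [hΓ f hf, map_zero, Submodule.coe_zero]; exact (rtFlux_zero _ _).symm]
  simp [jumpPairing]

/-! ### Normal traces of the extension operator -/

theorem InIface.onGamma (hM : M.IsMesh) {g : M.Iface} {T : M.Cell (M.upper g)}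
    {k : Fin (M.dim (M.upper g) + 1)} (h : M.InIface g T k) : M.OnGamma (M.upper g) T k :=
  ⟨M.lower g, (hM.dim_upper g).symm, h.1⟩

theorem OnGamma.exists_inIface (hM : M.IsMesh) {i : M.Sub} {T : M.Cell i}
    {k : Fin (M.dim i + 1)} (h : M.OnGamma i T k) :
    ∃ (g : M.Iface) (T' : M.Cell (M.upper g)) (k' : Fin (M.dim (M.upper g) + 1)),
      (⟨i, T, k⟩ : M.Facet) = ⟨M.upper g, T', k'⟩ ∧ M.InIface g T' k' := by
  obtain ⟨j, hj, hf⟩ := h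
  obtain ⟨g, ⟨rfl, rfl, hn⟩, -⟩ := hM.iface_complete i j T k hj hf
  exact ⟨g, T, k, rfl, hf, hn.symm⟩

theorem exists_inIface (hM : M.IsMesh) (g : M.Iface) : ∃ T k, M.InIface g T k := by
  obtain ⟨T₀⟩ := hM.cell_nonempty (M.lower g)
  obtain ⟨x, hx⟩ := (M.cell _ T₀).nonempty_closedInterior
  have hx' : x ∈ M.region (M.lower g) := Set.mem_iUnion.2 ⟨T₀, hx⟩
  rw [← hM.iface_cover g] at hx'
  simp only [Set.mem_iUnion] at hx'
  obtain ⟨T, k, h, -⟩ := hx'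
  exact ⟨T, k, h⟩

theorem measure_region_inter_region (hM : M.IsMesh) {i j : M.Sub} (hdim : M.dim i = M.dim j)
    (hij : i ≠ j) : μHE[M.dim i] (M.region i ∩ M.region j) = 0 := by
  simp only [region, Set.iUnion_inter, Set.inter_iUnion, measure_iUnion_null_iff]
  exact fun T' T => hM.cell_overlap i j T T' hdim fun h => hij (congrArg Sigma.fst h)

theorem eq_of_facet_subset_region (hM : M.IsMesh) {i j j' : M.Sub} {T : M.Cell i}
    {k : Fin (M.dim i + 1)} (hj : M.dim i = M.dim j + 1) (hj' : M.dim i = M.dim j' + 1)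
    (h : facet (M.cell i T) k ⊆ M.region j) (h' : facet (M.cell i T) k ⊆ M.region j') :
    j = j' := by
  by_contra hne
  exact (measure_facet_pos (M.cell i T) hj k).ne' (measure_mono_null (Set.subset_inter h h')
    (measure_region_inter_region hM (by lia) hne))

theorem InIface.unique (hM : M.IsMesh) {g g' : M.Iface} {T : M.Cell (M.upper g)}
    {T' : M.Cell (M.upper g')} {k : Fin (M.dim (M.upper g) + 1)}
    {k' : Fin (M.dim (M.upper g') + 1)} (h : M.InIface g T k) (h' : M.InIface g' T' k')
    (hf : (⟨M.upper g, T, k⟩ : M.Facet) = ⟨M.upper g', T', k'⟩) : g = g' := by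
  have hupper : M.upper g = M.upper g' := congrArg Sigma.fst hf
  have hfacet : facet (M.cell _ T) k = facet (M.cell _ T') k' := by
    simpa only using congrArg (fun f : M.Facet => facet (M.cell f.1 f.2.1) f.2.2) hf
  have hnormal : outerNormal (M.cell _ T) k = outerNormal (M.cell _ T') k' := by
    simpa only using congrArg (fun f : M.Facet => outerNormal (M.cell f.1 f.2.1) f.2.2) hf
  have hlower : M.lower g = M.lower g' := eq_of_facet_subset_region hM (hM.dim_upper g)
    ((congrArg M.dim hupper).trans (hM.dim_upper g')) h.1 (hfacet.subset.trans h'.1)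
  exact (hM.iface_complete _ _ T k (hM.dim_upper g).symm h.1).unique ⟨rfl, rfl, h.2.symm⟩
    ⟨hlower.symm, hupper.symm, (hnormal.trans h'.2).symm⟩

open Classical in
theorem sum_ite_inIface_single_mul (hM : M.IsMesh) {g : M.Iface} {T : M.Cell (M.upper g)}
    {k : Fin (M.dim (M.upper g) + 1)} (h : M.InIface g T k)
    (F : ∀ g, M.Cell (M.upper g) → Fin (M.dim (M.upper g) + 1) → ℝ) :
    (∑ g', ∑ T', ∑ k', if M.InIface g' T' k' then
      (Pi.single ⟨M.upper g, T, k⟩ 1 : M.Facet → ℝ) ⟨M.upper g', T', k'⟩ * F g' T' k' else 0) =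
      F g T k := by
  rw [Fintype.sum_eq_single g, Fintype.sum_eq_single T, Fintype.sum_eq_single k]
  · rw [if_pos h, Pi.single_eq_same, one_mul]
  · intro k' hk
    rw [Pi.single_eq_of_ne (by rintro ⟨⟩; exact hk rfl), zero_mul, ite_self]
  · intro T' hT
    refine Finset.sum_eq_zero fun k' _ => ?_
    rw [Pi.single_eq_of_ne (by rintro ⟨⟩; exact hT rfl), zero_mul, ite_self]
  · refine fun g' hg => Finset.sum_eq_zero fun T' _ => Finset.sum_eq_zero fun k' _ => ?_
    refine ite_eq_right_iff.2 fun h' => ?_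
    rw [Pi.single_eq_of_ne fun hf => hg (h'.unique hM h hf), zero_mul]

theorem sum_measureReal_inter_mcell_pos (hM : M.IsMesh) (g : M.Iface) {S : Set (E n)}
    (hS : S ⊆ M.region (M.lower g)) (hpos : 0 < μHE[M.dim (M.lower g)] S) :
    0 < ∑ m, (μHE[M.dim (M.lower g)]).real (S ∩ (M.mcell g m).closedInterior) := by
  have hfinite (m) : μHE[M.dim (M.lower g)] (S ∩ (M.mcell g m).closedInterior) ≠ ⊤ :=
    ((measure_mono Set.inter_subset_right).trans_lt (measure_closedInterior_lt_top _)).ne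
  have hcover : S = ⋃ m, S ∩ (M.mcell g m).closedInterior := by
    rw [← Set.inter_iUnion, hM.mortar_cover g, Set.inter_eq_left.2 hS]
  refine Finset.sum_pos' (fun m _ => measureReal_nonneg) ?_
  by_contra! hnull
  rw [hcover] at hpos
  refine hpos.ne' (measure_iUnion_null fun m => ?_)
  exact (measureReal_eq_zero_iff (hfinite m)).1
    ((hnull m (Finset.mem_univ m)).antisymm measureReal_nonneg)

section Extension

variable (hM : M.IsMesh) {R : M.Lh →ₗ[ℝ] M.Vh} (hR : M.IsExtension R)

include hM hR

theorem flux_extension_mul_measureReal (μ : M.Lh) {g : M.Iface} {T : M.Cell (M.upper g)}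
    {k : Fin (M.dim (M.upper g) + 1)} (h : M.InIface g T k) :
    M.flux (R μ) _ T k * (μHE[M.dim (M.lower g)]).real (facet (M.cell _ T) k) =
      ∑ m, μ g m * (μHE[M.dim (M.lower g)]).real
        (facet (M.cell _ T) k ∩ (M.mcell g m).closedInterior) := by
  classical
  have hdim (g) : 0 < M.dim (M.upper g) := by rw [hM.dim_upper g]; lia
  have hc : IsNormalFlux (Pi.single (⟨M.upper g, T, k⟩ : M.Facet) (1 : ℝ)) :=
    .of_forall_not_onGamma fun f hf =>
      Pi.single_eq_of_ne (by rintro rfl; exact hf (h.onGamma hM)) _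
  have htest := (hR μ).1 _ (fieldOfFlux_mem_Vh hM hc)
  simp only [traceTrace, mortarTrace, flux_fieldOfFlux hM _ (hdim _), mul_assoc,
    mul_left_comm _ ((Pi.single _ 1 : M.Facet → ℝ) _), ← Finset.mul_sum] at htest
  rwa [sum_ite_inIface_single_mul hM h fun g T k => M.flux (R μ) _ T k *
      (μHE[M.dim (M.lower g)]).real (facet (M.cell _ T) k),
    sum_ite_inIface_single_mul hM h fun g T k => ∑ m, μ g m * (μHE[M.dim (M.lower g)]).real
      (facet (M.cell _ T) k ∩ (M.mcell g m).closedInterior)] at htest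

theorem flux_extension_nonneg {μ : M.Lh} (hμ : 0 ≤ μ) {i : M.Sub} {T : M.Cell i}
    {k : Fin (M.dim i + 1)} (h : M.OnGamma i T k) : 0 ≤ M.flux (R μ) i T k := by
  obtain ⟨g, T, k, ⟨⟩, hin⟩ := h.exists_inIface hM
  refine nonneg_of_mul_nonneg_left ?_ (measureReal_facet_pos (M.cell _ T) (hM.dim_upper g) k)
  rw [flux_extension_mul_measureReal hM hR μ hin]
  exact Finset.sum_nonneg fun m _ => mul_nonneg (hμ g m) measureReal_nonneg

variable [DecidableEq M.Iface]

theorem flux_extension_single_of_ne {g : M.Iface} {i : M.Sub} (hi : i ≠ M.upper g)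
    {T : M.Cell i} {k : Fin (M.dim i + 1)} (h : M.OnGamma i T k) :
    M.flux (R (Pi.single g 1)) i T k = 0 := by
  obtain ⟨g', T, k, ⟨⟩, hin⟩ := h.exists_inIface hM
  have hg : g' ≠ g := by rintro rfl; exact hi rfl
  have hproj := flux_extension_mul_measureReal hM hR (Pi.single g 1) hin
  simp only [Pi.single_eq_of_ne hg, Pi.zero_apply, zero_mul, Finset.sum_const_zero] at hproj
  exact (mul_eq_zero.1 hproj).resolve_right
    (measureReal_facet_pos (M.cell _ T) (hM.dim_upper g') k).ne'

theorem flux_extension_single_pos {g : M.Iface} {T : M.Cell (M.upper g)}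
    {k : Fin (M.dim (M.upper g) + 1)} (h : M.InIface g T k) :
    0 < M.flux (R (Pi.single g 1)) _ T k := by
  refine pos_of_mul_pos_left ?_ (measureReal_nonneg (μ := μHE[M.dim (M.lower g)])
    (s := facet (M.cell _ T) k))
  rw [flux_extension_mul_measureReal hM hR _ h]
  simp only [Pi.single_eq_same, Pi.one_apply, one_mul]
  exact sum_measureReal_inter_mcell_pos hM g h.1 (measure_facet_pos _ (hM.dim_upper g) k)

end Extension

end MeshData

/-! ### The kernel of `b` -/

namespace MeshData

variable {n : ℕ} {M : MeshData n}

section Kernel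

variable (hM : M.IsMesh) {R : M.Lh →ₗ[ℝ] M.Vh} {q : M.Qh} (hq : ∀ r, b R r q = 0)

include hM hq

theorem sign_pressure_eq_of_interiorPair {i : M.Sub} {T T' : M.Cell i} {k k' : Fin (M.dim i + 1)}
    (h : M.InteriorPair i T k T' k') : SignType.sign (q i T) = SignType.sign (q i T') := by
  classical
  have hpair : FacetPair ⟨i, T, k⟩ ⟨i, T', k'⟩ := ⟨h⟩
  have hsum := sum_mul_facetWeight_eq_zero hM hq (IsNormalFlux.single_sub_single hM hpair)
    fun f hf => by
      rw [Pi.sub_apply, Pi.single_eq_of_ne (by rintro rfl; exact hpair.not_onGamma hf),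
        Pi.single_eq_of_ne (by rintro rfl; exact hpair.symm.not_onGamma hf), sub_zero]
  simp only [Pi.sub_apply, sub_mul, Finset.sum_sub_distrib, Pi.single_apply, ite_mul, one_mul,
    zero_mul, Finset.sum_ite_eq', Finset.mem_univ, if_true, sub_eq_zero] at hsum
  have hsign := congrArg SignType.sign hsum
  rwa [sign_mul, sign_mul, sign_pos (facetWeight_pos h.1), sign_pos (facetWeight_pos h.1), mul_one,
    mul_one] at hsign

theorem sign_pressure_eq {i : M.Sub} (T T' : M.Cell i) :
    SignType.sign (q i T) = SignType.sign (q i T') := by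
  induction hM.sub_connected i T T' with
  | refl => rfl
  | tail _ hstep ih =>
    obtain ⟨k, k', hpair⟩ := hstep
    exact ih.trans (sign_pressure_eq_of_interiorPair hM hq hpair)

theorem pressure_eq_zero_of_dirichletFacet {i : M.Sub} {T : M.Cell i} {k : Fin (M.dim i + 1)}
    (h : M.DirichletFacet i T k) : q i = 0 := by
  classical
  have hsum := sum_mul_facetWeight_eq_zero hM hq
    (IsNormalFlux.single_of_dirichletFacet (f := ⟨i, T, k⟩) h)
    fun f hf => Pi.single_eq_of_ne (by rintro rfl; exact h.1.2.1 hf) _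
  simp only [Pi.single_apply, ite_mul, one_mul, zero_mul, Finset.sum_ite_eq', Finset.mem_univ,
    if_true] at hsum
  have hT : q i T = 0 := (mul_eq_zero.1 hsum).resolve_right (facetWeight_pos h.1.1).ne'
  funext T'
  rw [Pi.zero_apply, ← sign_eq_zero_iff, sign_pressure_eq hM hq T' T, hT, sign_zero]

end Kernel

section Interface

variable {R : M.Lh →ₗ[ℝ] M.Vh}

open Classical in
/-- The normal trace on `Γ` of the extension of the indicator function of the interface `g`,
extended by zero to all the facets. -/
def ifaceFlux (R : M.Lh →ₗ[ℝ] M.Vh) (g : M.Iface) (f : M.Facet) : ℝ :=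
  if M.OnGamma f.1 f.2.1 f.2.2 then M.flux (R (Pi.single g 1)) f.1 f.2.1 f.2.2 else 0

theorem isNormalFlux_ifaceFlux (g : M.Iface) : IsNormalFlux (ifaceFlux R g) :=
  .of_forall_not_onGamma fun _ hf => if_neg hf

open Classical in
theorem jumpPairing_single (q : M.Qh) (g : M.Iface) :
    jumpPairing q (Pi.single g 1) = -∑ T, (∑ m, (μHE[M.dim (M.lower g)]).real
      ((M.cell _ T).closedInterior ∩ (M.mcell g m).closedInterior)) * q (M.lower g) T := by
  rw [jumpPairing, Fintype.sum_eq_single g]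
  · simp only [Pi.single_eq_same, Pi.one_apply, one_mul, ← Finset.mul_sum, mul_comm]
  · intro g' hg
    simp [Pi.single_eq_of_ne hg]

variable (hM : M.IsMesh) (hR : M.IsExtension R)

include hM hR

theorem ifaceFlux_nonneg (g : M.Iface) (f : M.Facet) : 0 ≤ ifaceFlux R g f := by
  classical
  rw [ifaceFlux]
  split_ifs with hΓ
  · exact flux_extension_nonneg hM hR (Pi.single_nonneg.2 zero_le_one) hΓ
  · exact le_rfl

theorem ifaceFlux_of_ne {g : M.Iface} {f : M.Facet} (hf : f.1 ≠ M.upper g) :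
    ifaceFlux R g f = 0 := by
  classical
  exact ite_eq_right_iff.2 fun hΓ => flux_extension_single_of_ne hM hR hf hΓ

theorem ifaceFlux_pos {g : M.Iface} {T : M.Cell (M.upper g)} {k : Fin (M.dim (M.upper g) + 1)}
    (h : M.InIface g T k) : 0 < ifaceFlux R g ⟨M.upper g, T, k⟩ := by
  classical
  rw [ifaceFlux, if_pos (h.onGamma hM)]
  exact flux_extension_single_pos hM hR h

variable {q : M.Qh} (hq : ∀ r, b R r q = 0)

include hq

theorem iface_balance (g : M.Iface) :
    ∑ x, facetWeight (⟨M.upper g, x⟩ : M.Facet) * ifaceFlux R g ⟨M.upper g, x⟩ *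
      q (M.upper g) x.1 = ∑ T, (∑ m, (μHE[M.dim (M.lower g)]).real
        ((M.cell _ T).closedInterior ∩ (M.mcell g m).closedInterior)) * q (M.lower g) T := by
  classical
  have hsum := sum_mul_facetWeight_eq hM hq (isNormalFlux_ifaceFlux g) (Pi.single g 1)
    fun f hf => if_pos hf
  rw [jumpPairing_single, neg_neg, Fintype.sum_sigma, Fintype.sum_eq_single (M.upper g)] at hsum
  · rw [← hsum]
    exact Finset.sum_congr rfl fun x _ => by ring
  · exact fun i hi => Finset.sum_eq_zero fun x _ => by
      rw [ifaceFlux_of_ne hM hR (by exact hi), zero_mul]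

theorem pressure_lower_eq_zero_iff (g : M.Iface) : q (M.lower g) = 0 ↔ q (M.upper g) = 0 := by
  have hbalance := iface_balance hM hR hq g
  constructor
  · intro hlower
    obtain ⟨T₀, k₀, hin⟩ := exists_inIface hM g
    have hdim : 0 < M.dim (M.upper g) := (hin.onGamma hM).dim_pos
    simp only [hlower, Pi.zero_apply, mul_zero, Finset.sum_const_zero] at hbalance
    funext T
    exact eq_zero_of_sum_mul_eq_zero_of_sign_eq
      (fun x => mul_nonneg (facetWeight_pos hdim).le (ifaceFlux_nonneg hM hR g _))
      (i₀ := (T₀, k₀)) (mul_pos (facetWeight_pos hdim) (ifaceFlux_pos hM hR hin))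
      (fun x y => sign_pressure_eq hM hq x.1 y.1) hbalance (T, 0)
  · intro hupper
    obtain ⟨T₀⟩ := hM.cell_nonempty (M.lower g)
    have hweight (T : M.Cell (M.lower g)) := sum_measureReal_inter_mcell_pos hM g
      (Set.subset_iUnion (fun T => (M.cell _ T).closedInterior) T) (measure_closedInterior_pos _)
    simp only [hupper, Pi.zero_apply, mul_zero, Finset.sum_const_zero] at hbalance
    funext T
    exact eq_zero_of_sum_mul_eq_zero_of_sign_eq (fun T => (hweight T).le) (hweight T₀)
      (sign_pressure_eq hM hq) hbalance.symm T

theorem eq_zero_of_forall_b_eq_zero : q = 0 := by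
  obtain ⟨i₀, T₀, k₀, hD⟩ := hM.dirichlet
  have hiff (i j) (h : Relation.EqvGen (fun i j => ∃ g, M.lower g = i ∧ M.upper g = j) i j) :
      q i = 0 ↔ q j = 0 := by
    induction h with
    | rel i j h =>
      obtain ⟨g, rfl, rfl⟩ := h
      exact pressure_lower_eq_zero_iff hM hR hq g
    | refl => exact Iff.rfl
    | symm _ _ _ ih => exact ih.symm
    | trans _ _ _ _ _ ih₁ ih₂ => exact ih₁.trans ih₂
  funext i
  exact (hiff i₀ i (hM.connected i₀ i)).1 (pressure_eq_zero_of_dirichletFacet hM hq hD)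

end Interface

/-! ### The discrete gradient and the composite form -/

/-- The form `b` as a linear map from `Q_h` to the dual of `W_h`. -/
def bForm (R : M.Lh →ₗ[ℝ] M.Vh) : M.Qh →ₗ[ℝ] Module.Dual ℝ M.Wh :=
  LinearMap.mk₂ ℝ (fun q r => b R r q)
    (fun q q' r => by
      simp only [b, jumpPairing, Pi.add_apply, add_mul, Finset.sum_add_distrib]; ring)
    (fun c q r => by
      simp only [b, jumpPairing, Pi.smul_apply, smul_eq_mul, mul_neg, mul_add, Finset.mul_sum,
        mul_assoc])
    (fun q r r' => by
      simp only [b, jumpPairing, rtDiv, ← Params.totalOn_apply, map_add, Prod.snd_add,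
        Pi.add_apply, mul_add, add_mul, Finset.sum_add_distrib]; ring)
    (fun c q r => by
      simp only [b, jumpPairing, rtDiv, ← Params.totalOn_apply, map_smul, Prod.smul_snd,
        Pi.smul_apply, smul_eq_mul, mul_neg, mul_add, Finset.mul_sum, mul_assoc, mul_left_comm c])

namespace Params

variable (P : M.Params) {R : M.Lh →ₗ[ℝ] M.Vh} (hM : M.IsMesh)

include hM

theorem existsUnique_isDiscreteGradient (R : M.Lh →ₗ[ℝ] M.Vh) :
    ∃! G : M.Qh →ₗ[ℝ] M.Wh, P.IsDiscreteGradient R G := by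
  have hinj : Function.Injective (P.aDForm R) := by
    refine (injective_iff_map_eq_zero _).2 fun w hw => ?_
    exact eq_zero_of_aDForm_self_eq_zero (P := P) R hM (by rw [hw, LinearMap.zero_apply])
  let e : M.Wh ≃ₗ[ℝ] Module.Dual ℝ M.Wh :=
    LinearEquiv.ofInjectiveOfFinrankEq (P.aDForm R) hinj Subspace.dual_finrank_eq.symm
  have hgradient : P.IsDiscreteGradient R (e.symm.toLinearMap ∘ₗ bForm R) := fun p r => by
    rw [← aDForm_apply]
    exact LinearMap.congr_fun (e.apply_symm_apply (bForm R p)) r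
  refine ⟨_, hgradient, fun G hG => LinearMap.ext fun p => hinj (LinearMap.ext fun r => ?_)⟩
  rw [aDForm_apply, aDForm_apply, hG p r, hgradient p r]

variable {P} {G : M.Qh →ₗ[ℝ] M.Wh}

theorem weightedNorm_pos (hR : M.IsExtension R) (hG : P.IsDiscreteGradient R G)
    {y : M.Wh × M.Qh} (hy : y ≠ 0) : 0 < P.weightedNorm R G y := by
  have ha := (P.aForm_isPosSemidef R hM).nonneg y.1
  have haD := (P.aDForm_isPosSemidef R hM).nonneg (G y.2)
  refine Real.sqrt_pos.2 ?_
  rw [← aForm_apply, ← aDForm_apply]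
  refine (add_nonneg ha haD).lt_of_ne' fun hzero => hy ?_
  rw [add_eq_zero_iff_of_nonneg ha haD] at hzero
  have hG_zero : G y.2 = 0 := eq_zero_of_aDForm_self_eq_zero R hM hzero.2
  refine Prod.ext (eq_zero_of_aForm_self_eq_zero R hM hzero.1)
    (eq_zero_of_forall_b_eq_zero hM hR fun r => ?_)
  rw [← hG y.2 r, hG_zero, ← aDForm_apply, map_zero, LinearMap.zero_apply]

theorem abs_compositeForm_le {σ κ : ℝ} (hσ : M.ShapeRegular σ) (hκ : P.AnisotropyLE κ)
    (x y : M.Wh × M.Qh) : |P.compositeForm R G x y| ≤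
      (1 + 2 * √(lumpingBound n σ κ)) * P.weightedNorm R G x * P.weightedNorm R G y := by
  simp only [compositeForm, weightedNorm, ← aForm_apply, ← aDForm_apply]
  exact abs_saddle_le (P.aForm_isPosSemidef R hM) (P.aDForm_isPosSemidef R hM)
    (zero_le_one.trans (one_le_lumpingBound n σ κ)) (aDForm_self_le R hM hσ hκ) _ _ _ _

theorem exists_le_compositeForm (y : M.Wh × M.Qh) (hy : y ≠ 0) :
    ∃ x ≠ 0, 1 / (4 * (n + 1)) * (P.weightedNorm R G x * P.weightedNorm R G y) ≤
      P.compositeForm R G x y := by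
  refine ⟨(y.1 + (n + 1 : ℝ)⁻¹ • G y.2, -y.2), fun hx => hy ?_, ?_⟩
  · have hsnd : y.2 = 0 := neg_eq_zero.1 (congrArg Prod.snd hx)
    have hfst : y.1 + (n + 1 : ℝ)⁻¹ • G y.2 = 0 := congrArg Prod.fst hx
    rw [hsnd, map_zero, smul_zero, add_zero] at hfst
    exact Prod.ext hfst hsnd
  · simp only [compositeForm, weightedNorm, ← aForm_apply, ← aDForm_apply, map_neg G]
    exact le_saddle (P.aForm_isPosSemidef R hM) (P.aDForm_isPosSemidef R hM).isNonneg (by simp)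
      (P.aForm_self_le R hM) y.1 (G y.2)

theorem le_iInf_iSup_compositeForm (hR : M.IsExtension R) (hG : P.IsDiscreteGradient R G) :
    ((1 / (4 * (n + 1)) : ℝ) : EReal) ≤
      ⨅ (y : M.Wh × M.Qh) (_ : y ≠ 0), ⨆ (x : M.Wh × M.Qh) (_ : x ≠ 0),
        ((P.compositeForm R G x y / (P.weightedNorm R G x * P.weightedNorm R G y) : ℝ) :
          EReal) := by
  refine le_iInf₂ fun y hy => ?_
  obtain ⟨x, hx, hle⟩ := exists_le_compositeForm (P := P) (R := R) (G := G) hM y hy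
  refine le_iSup₂_of_le x hx (EReal.coe_le_coe_iff.2 ?_)
  exact (le_div_iff₀ (mul_pos (weightedNorm_pos hM hR hG hx) (weightedNorm_pos hM hR hG hy))).2 hle

end Params

end MeshData

end MixedDim

end

open MixedDim.MeshData in
theorem mainTheorem1_general (n : ℕ) :
    ∃ β : ℝ, 0 < β ∧ ∀ σ κ : ℝ, ∃ α : ℝ, 0 < α ∧
      ∀ M : MixedDim.MeshData n, M.IsMesh →
      ∀ (P : M.Params) (R : M.Lh →ₗ[ℝ] M.Vh), M.IsExtension R →
        (∃! G : M.Qh →ₗ[ℝ] M.Wh, P.IsDiscreteGradient R G) ∧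
        ∀ G : M.Qh →ₗ[ℝ] M.Wh, P.IsDiscreteGradient R G →
          (M.ShapeRegular σ → P.AnisotropyLE κ → ∀ x y : M.Wh × M.Qh,
            |P.compositeForm R G x y| ≤ α * P.weightedNorm R G x * P.weightedNorm R G y) ∧
          (β : EReal) ≤ ⨅ (y : M.Wh × M.Qh) (_ : y ≠ 0), ⨆ (x : M.Wh × M.Qh) (_ : x ≠ 0),
            ((P.compositeForm R G x y / (P.weightedNorm R G x * P.weightedNorm R G y) : ℝ) :
              EReal) := by
  refine ⟨1 / (4 * (n + 1)), by positivity, fun σ κ =>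
    ⟨1 + 2 * √(Params.lumpingBound n σ κ), by positivity, fun M hM P R hR =>
      ⟨P.existsUnique_isDiscreteGradient hM R, fun G hG => ⟨fun hσ hκ => ?_, ?_⟩⟩⟩⟩
  · exact Params.abs_compositeForm_le hM hσ hκ
  · exact Params.le_iInf_iSup_compositeForm hM hR hG

theorem mainTheorem1 (n : ℕ) (hn : n = 2 ∨ n = 3) (σ : ℝ) :
    ∃ β : ℝ, 0 < β ∧ ∀ κ : ℝ, ∃ α : ℝ, 0 < α ∧
      ∀ (M : MixedDim.MeshData n), M.IsMesh → M.ShapeRegular σ →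
      ∀ (P : M.Params) (R : M.Lh →ₗ[ℝ] M.Vh), M.IsExtension R →
        (∃! G : M.Qh →ₗ[ℝ] M.Wh, P.IsDiscreteGradient R G) ∧
        ∀ G : M.Qh →ₗ[ℝ] M.Wh, P.IsDiscreteGradient R G →
          (P.AnisotropyLE κ → ∀ x y : M.Wh × M.Qh,
            |P.compositeForm R G x y| ≤ α * P.weightedNorm R G x * P.weightedNorm R G y) ∧
          (β : EReal) ≤ ⨅ (y : M.Wh × M.Qh) (_ : y ≠ 0), ⨆ (x : M.Wh × M.Qh) (_ : x ≠ 0),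
            ((P.compositeForm R G x y / (P.weightedNorm R G x * P.weightedNorm R G y) : ℝ) :
              EReal) := by
  obtain ⟨β, hβ, hgeneral⟩ := mainTheorem1_general n
  refine ⟨β, hβ, fun κ => (hgeneral σ κ).imp fun α ⟨hα, h⟩ => ⟨hα, fun M hM hσ P R hR => ?_⟩⟩
  exact (h M hM P R hR).imp_right fun h G hG => (h G hG).imp_left fun h => h hσ
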